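/- Let $F$ be a field which is complete for a non-trivial discrete non-archimedean absolute value $|\cdot|$ (for example $F=W(k)[1/p]$ with $k$ a perfect field of characteristic $p$), and let $0<\alpha<1$. Let $R=\mathcal{H}_F^{\alpha}$ be the ring of analytic functions with coefficients in $F$ on the half-open annulus $\{\alpha\le |T|<1\}$, that is, the ring of Laurent series $\sum_{k\in\mathbf{Z}}a_kT^k$ with $a_k\in F$ and $\lim_{k\to\pm\infty}|a_k|\rho^k=0$ for every $\rho\in[\alpha,1)$, endowed with the Fréchet topology defined by the norms $\left|\sum_k a_kT^k\right|_\rho=\sup_k|a_k|\rho^k$, $\rho\in[\alpha,1)$. (When $F=W(k)[1/p]$ with $|p|=p^{-1}$, $K$ is a finite totally ramified extension of $F$, $s$ is large enough and $\alpha=p^{-1/(e_Ks)}$ with $e_K=[K(\mu_{p^\infty}):F(\mu_{p^\infty})]$, this topological ring is identified with $\mathbf{B}^{\dagger,s}_{\mathrm{rig},K}$.) The ring $R$ is an integral domain. Let $M$ be a free $R$-module of finite rank $d$, endowed with the topology obtained by transporting the product topology of $R^d$ through a basis of $M$, and let $N\subset M$ be a closed $R$-submodule. 1. If $N\otimes_R\operatorname{Frac}(R)=M\otimes_R\operatorname{Frac}(R)$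 (that is, the natural map from the left-hand side to the right-hand side is onto), then $N$ is free of rank $d$. 2. In general, let $e=\dim_{\operatorname{Frac}(R)}\bigl(N\otimes_R\operatorname{Frac}(R)\bigr)$. Then $e\le d$ and $N$ is free of rank $e$. -/

import Mathlib

open Filter Topology TensorProduct

noncomputable section

/-- A doubly infinite sequence `a : ℤ → F` is the coefficient sequence of a Laurent series
`∑ aₖ Tᵏ` converging on the half-open annulus `α ≤ |T| < 1` when `|aₖ| ρᵏ → 0` as `k → ± ∞`
for every `ρ ∈ [α, 1)` (on `ℤ`, the filter `cofinite` is "`k → ± ∞`"). -/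
def ConvergesOnAnnulus {F : Type*} [NormedField F] (α : ℝ) (a : ℤ → F) : Prop :=
  ∀ ρ ∈ Set.Ico α 1, Tendsto (fun k : ℤ => ‖a k‖ * ρ ^ k) cofinite (𝓝 0)

/-- The `F`-vector space of the Laurent series with coefficients in `F` that converge on the
half-open annulus `α ≤ |T| < 1`. -/
def annulusSubmodule (F : Type*) [NormedField F] (α : Set.Ioo (0 : ℝ) 1) :
    Submodule F (ℤ → F) where
  carrier := {a | ConvergesOnAnnulus (α : ℝ) a}
  zero_mem' := by
    intro ρ _
    simp
  add_mem' := by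
    intro a b ha hb ρ hρ
    have hρ0 : 0 < ρ := α.2.1.trans_le hρ.1
    have h := (ha ρ hρ).add (hb ρ hρ)
    rw [add_zero] at h
    refine squeeze_zero (fun k => by positivity) (fun k => ?_) h
    rw [← add_mul]
    exact mul_le_mul_of_nonneg_right (norm_add_le _ _) (by positivity)
  smul_mem' := by
    intro c a ha ρ hρ
    have h := (ha ρ hρ).const_mul ‖c‖
    rw [mul_zero] at h
    refine h.congr (fun k => ?_)
    simp [mul_assoc]

/-- The ring of analytic functions `∑ aₖ Tᵏ`, with coefficients in `F`, on the half-open annulus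
`α ≤ |T| < 1`. -/
def AnnulusRing (F : Type*) [NormedField F] (α : Set.Ioo (0 : ℝ) 1) : Type _ :=
  annulusSubmodule F α

namespace AnnulusRing

variable {F : Type*} [NormedField F] {α : Set.Ioo (0 : ℝ) 1}

instance : AddCommGroup (AnnulusRing F α) :=
  inferInstanceAs (AddCommGroup (annulusSubmodule F α))

instance : Module F (AnnulusRing F α) :=
  inferInstanceAs (Module F (annulusSubmodule F α))

/-- The coefficient of `Tᵏ`. -/
def coeff (f : AnnulusRing F α) (k : ℤ) : F := f.1 k

@[ext]
theorem ext {f g : AnnulusRing F α} (h : ∀ k, f.coeff k = g.coeff k) : f = g :=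
  Subtype.ext (funext h)

@[simp] theorem coeff_zero (k : ℤ) : (0 : AnnulusRing F α).coeff k = 0 := rfl
@[simp] theorem coeff_add (f g : AnnulusRing F α) (k : ℤ) :
    (f + g).coeff k = f.coeff k + g.coeff k := rfl
@[simp] theorem coeff_smul (c : F) (f : AnnulusRing F α) (k : ℤ) :
    (c • f).coeff k = c * f.coeff k := rfl

theorem tendsto (f : AnnulusRing F α) {ρ : ℝ} (hρ : ρ ∈ Set.Ico (α : ℝ) 1) :
    Tendsto (fun k : ℤ => ‖f.coeff k‖ * ρ ^ k) cofinite (𝓝 0) := f.2 ρ hρ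

theorem pos_of_mem {ρ : ℝ} (hρ : ρ ∈ Set.Ico (α : ℝ) 1) : 0 < ρ := α.2.1.trans_le hρ.1

theorem self_mem (α : Set.Ioo (0 : ℝ) 1) : (α : ℝ) ∈ Set.Ico (α : ℝ) 1 := ⟨le_rfl, α.2.2⟩

instance : Nonempty (Set.Ico (α : ℝ) 1) := ⟨⟨α, self_mem α⟩⟩

theorem bddAbove (f : AnnulusRing F α) {ρ : ℝ} (hρ : ρ ∈ Set.Ico (α : ℝ) 1) :
    BddAbove (Set.range fun k : ℤ => ‖f.coeff k‖ * ρ ^ k) :=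
  (f.tendsto hρ).bddAbove_range_of_cofinite

/-- The Gauss norm `|∑ aₖ Tᵏ|_ρ = supₖ |aₖ| ρᵏ`, for a radius `ρ ∈ [α, 1)`. -/
def gaussSeminorm (F : Type*) [NormedField F] (α : Set.Ioo (0 : ℝ) 1)
    (ρ : Set.Ico (α : ℝ) 1) : Seminorm F (AnnulusRing F α) :=
  Seminorm.of (fun f => ⨆ k : ℤ, ‖f.coeff k‖ * (ρ : ℝ) ^ k)
    (by
      intro f g
      have hρ0 : 0 < (ρ : ℝ) := pos_of_mem ρ.2
      refine ciSup_le fun k => ?_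
      calc ‖(f + g).coeff k‖ * (ρ : ℝ) ^ k
          ≤ (‖f.coeff k‖ + ‖g.coeff k‖) * (ρ : ℝ) ^ k :=
            mul_le_mul_of_nonneg_right (norm_add_le _ _) (by positivity)
        _ = ‖f.coeff k‖ * (ρ : ℝ) ^ k + ‖g.coeff k‖ * (ρ : ℝ) ^ k := add_mul _ _ _
        _ ≤ _ := add_le_add (le_ciSup (f.bddAbove ρ.2) k) (le_ciSup (g.bddAbove ρ.2) k))
    (by
      intro c f
      rw [Real.mul_iSup_of_nonneg (norm_nonneg c)]
      simp [mul_assoc])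

/-- The Fréchet topology: the topology defined by the Gauss norms `|·|_ρ`, `ρ ∈ [α, 1)`.
As the supremum of `|·|_ρ` over `ρ ∈ [r, t]` is `max (|·|_r, |·|_t)`, it is the topology of
uniform convergence on the closed annuli `r ≤ |T| ≤ t` with `[r, t] ⊆ [α, 1)`. -/
instance : TopologicalSpace (AnnulusRing F α) :=
  SeminormFamily.moduleFilterBasis (𝕜 := F) (gaussSeminorm F α) |>.topology

/-! The ring structure. -/

theorem tendsto_mul_pair (f g : AnnulusRing F α) {ρ : ℝ} (hρ : ρ ∈ Set.Ico (α : ℝ) 1) :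
    Tendsto (fun p : ℤ × ℤ => (‖f.coeff p.1‖ * ρ ^ p.1) * (‖g.coeff p.2‖ * ρ ^ p.2))
      cofinite (𝓝 0) :=
  tendsto_mul_cofinite_nhds_zero (f.tendsto hρ) (g.tendsto hρ)

theorem tendsto_mul_triple (f g h : AnnulusRing F α) {ρ : ℝ} (hρ : ρ ∈ Set.Ico (α : ℝ) 1) :
    Tendsto (fun p : ℤ × ℤ × ℤ => (‖f.coeff p.1‖ * ρ ^ p.1) *
      ((‖g.coeff p.2.1‖ * ρ ^ p.2.1) * (‖h.coeff p.2.2‖ * ρ ^ p.2.2)))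
      cofinite (𝓝 0) :=
  tendsto_mul_cofinite_nhds_zero (f.tendsto hρ) (tendsto_mul_pair g h hρ)

/-- The family `(i, j) ↦ aᵢ bⱼ` restricted to `i + j = n` tends to `0`. -/
theorem tendsto_conv (f g : AnnulusRing F α) (n : ℤ) :
    Tendsto (fun i : ℤ => f.coeff i * g.coeff (n - i)) cofinite (𝓝 0) := by
  have hρ0 : 0 < (α : ℝ) := α.2.1
  have hinj : Function.Injective (fun i : ℤ => (i, n - i)) := fun i j h => (Prod.mk.inj h).1
  have h := ((tendsto_mul_pair f g (self_mem α)).comp hinj.tendsto_cofinite).mul_const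
    ((α : ℝ) ^ (-n))
  rw [zero_mul] at h
  refine tendsto_zero_iff_norm_tendsto_zero.2 (h.congr fun i => ?_)
  have e : (α : ℝ) ^ i * (α : ℝ) ^ (n - i) * (α : ℝ) ^ (-n) = 1 := by
    rw [← zpow_add₀ hρ0.ne', ← zpow_add₀ hρ0.ne']
    simp
  simp only [Function.comp, norm_mul]
  calc _ = ‖f.coeff i‖ * ‖g.coeff (n - i)‖ *
      ((α : ℝ) ^ i * (α : ℝ) ^ (n - i) * (α : ℝ) ^ (-n)) := by ring
    _ = _ := by rw [e, mul_one]

theorem tendsto_conv₃ (f g h : AnnulusRing F α) (n : ℤ) :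
    Tendsto (fun p : ℤ × ℤ => f.coeff p.2 * g.coeff (p.1 - p.2) * h.coeff (n - p.1))
      cofinite (𝓝 0) := by
  have hρ0 : 0 < (α : ℝ) := α.2.1
  have hinj : Function.Injective (fun p : ℤ × ℤ => (p.2, p.1 - p.2, n - p.1)) := by
    rintro ⟨i, j⟩ ⟨i', j'⟩ h
    simp only [Prod.mk.injEq] at h ⊢
    omega
  have H := ((tendsto_mul_triple f g h (self_mem α)).comp hinj.tendsto_cofinite).mul_const
    ((α : ℝ) ^ (-n))
  rw [zero_mul] at H
  refine tendsto_zero_iff_norm_tendsto_zero.2 (H.congr fun p => ?_)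
  have e : (α : ℝ) ^ p.2 * (α : ℝ) ^ (p.1 - p.2) * (α : ℝ) ^ (n - p.1) * (α : ℝ) ^ (-n) = 1 := by
    rw [← zpow_add₀ hρ0.ne', ← zpow_add₀ hρ0.ne', ← zpow_add₀ hρ0.ne']
    simp
  simp only [Function.comp, norm_mul]
  calc _ = ‖f.coeff p.2‖ * ‖g.coeff (p.1 - p.2)‖ * ‖h.coeff (n - p.1)‖ *
      ((α : ℝ) ^ p.2 * (α : ℝ) ^ (p.1 - p.2) * (α : ℝ) ^ (n - p.1) * (α : ℝ) ^ (-n)) := by ring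
    _ = _ := by rw [e, mul_one]

instance : One (AnnulusRing F α) where
  one := ⟨Pi.single 0 1, by
    intro ρ _
    refine tendsto_nhds_of_eventually_eq ?_
    refine (Set.finite_singleton (0 : ℤ)).subset fun k hk => ?_
    by_contra h
    exact hk (by simp [Pi.single_eq_of_ne h])⟩

theorem coeff_one (n : ℤ) : (1 : AnnulusRing F α).coeff n = if n = 0 then 1 else 0 :=
  Pi.single_apply 0 1 n

variable [IsUltrametricDist F]

/-- The product of Laurent series: the coefficient of `Tⁿ` is `∑ᵢ aᵢ bₙ₋ᵢ`. -/
instance : Mul (AnnulusRing F α) where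
  mul f g := ⟨fun n => ∑' i : ℤ, f.coeff i * g.coeff (n - i), by
    intro ρ hρ
    have hρ0 : 0 < ρ := pos_of_mem hρ
    have H := tendsto_mul_pair f g hρ
    rw [Metric.tendsto_nhds] at H ⊢
    intro ε hε
    have hfin : {p : ℤ × ℤ | ¬ dist ((‖f.coeff p.1‖ * ρ ^ p.1) * (‖g.coeff p.2‖ * ρ ^ p.2)) 0
        < ε / 2}.Finite := H (ε / 2) (half_pos hε)
    refine (hfin.image fun p : ℤ × ℤ => p.1 + p.2).subset ?_
    intro n hn
    by_contra hcon
    apply hn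
    have key : ∀ i : ℤ, ‖f.coeff i * g.coeff (n - i)‖ ≤ ε / 2 * ρ ^ (-n) := by
      intro i
      have h1 : dist ((‖f.coeff i‖ * ρ ^ i) * (‖g.coeff (n - i)‖ * ρ ^ (n - i))) 0 < ε / 2 := by
        by_contra h2
        exact hcon ⟨(i, n - i), h2, by simp⟩
      rw [Real.dist_0_eq_abs] at h1
      have h3 := (lt_of_abs_lt h1).le
      have e : ρ ^ i * ρ ^ (n - i) * ρ ^ (-n) = 1 := by
        rw [← zpow_add₀ hρ0.ne', ← zpow_add₀ hρ0.ne']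
        simp
      calc ‖f.coeff i * g.coeff (n - i)‖ = ‖f.coeff i‖ * ‖g.coeff (n - i)‖ *
            (ρ ^ i * ρ ^ (n - i) * ρ ^ (-n)) := by rw [e, mul_one, norm_mul]
        _ = (‖f.coeff i‖ * ρ ^ i) * (‖g.coeff (n - i)‖ * ρ ^ (n - i)) * ρ ^ (-n) := by ring
        _ ≤ _ := mul_le_mul_of_nonneg_right h3 (by positivity)
    have h4 := IsUltrametricDist.norm_tsum_le_of_forall_le_of_nonneg (by positivity) key
    have h5 := mul_le_mul_of_nonneg_right h4 (zpow_pos hρ0 n).le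
    rw [mul_assoc, ← zpow_add₀ hρ0.ne', neg_add_cancel, zpow_zero, mul_one] at h5
    change dist _ _ < ε
    rw [Real.dist_0_eq_abs, abs_of_nonneg (by positivity)]
    exact h5.trans_lt (half_lt_self hε)⟩

theorem coeff_mul (f g : AnnulusRing F α) (n : ℤ) :
    (f * g).coeff n = ∑' i : ℤ, f.coeff i * g.coeff (n - i) := rfl

protected theorem mul_comm (f g : AnnulusRing F α) : f * g = g * f := by
  ext n
  rw [coeff_mul, coeff_mul, ← (Equiv.subLeft n).tsum_eq]
  simp [mul_comm]

protected theorem one_mul (f : AnnulusRing F α) : 1 * f = f := by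
  ext n
  rw [coeff_mul, tsum_eq_single 0]
  · simp [coeff_one]
  · intro i hi
    simp [coeff_one, hi]

variable [CompleteSpace F]

theorem summable_conv (f g : AnnulusRing F α) (n : ℤ) :
    Summable fun i : ℤ => f.coeff i * g.coeff (n - i) :=
  NonarchimedeanAddGroup.summable_of_tendsto_cofinite_zero (tendsto_conv f g n)

protected theorem add_mul (f g h : AnnulusRing F α) : (f + g) * h = f * h + g * h := by
  ext n
  simp only [coeff_mul, coeff_add, add_mul]
  exact (summable_conv f h n).tsum_add (summable_conv g h n)

protected theorem mul_assoc (f g h : AnnulusRing F α) : f * g * h = f * (g * h) := by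
  ext n
  have hs : Summable (Function.uncurry fun k i : ℤ =>
      f.coeff i * g.coeff (k - i) * h.coeff (n - k)) :=
    NonarchimedeanAddGroup.summable_of_tendsto_cofinite_zero (tendsto_conv₃ f g h n)
  simp only [coeff_mul]
  calc ∑' k, (∑' i, f.coeff i * g.coeff (k - i)) * h.coeff (n - k)
      = ∑' k, ∑' i, f.coeff i * g.coeff (k - i) * h.coeff (n - k) := by
        simp only [tsum_mul_right]
    _ = ∑' i, ∑' k, f.coeff i * g.coeff (k - i) * h.coeff (n - k) := hs.tsum_comm.symm
    _ = ∑' i, f.coeff i * ∑' j, g.coeff j * h.coeff (n - i - j) := by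
        refine tsum_congr fun i => ?_
        rw [← tsum_mul_left, ← (Equiv.addRight i).tsum_eq]
        refine tsum_congr fun j => ?_
        simp only [Equiv.coe_addRight, add_sub_cancel_right, mul_assoc]
        rw [show n - (j + i) = n - i - j by ring]

instance : CommRing (AnnulusRing F α) :=
  { (inferInstance : AddCommGroup (AnnulusRing F α)) with
    mul := (· * ·)
    one := 1
    mul_assoc := AnnulusRing.mul_assoc
    mul_comm := AnnulusRing.mul_comm
    one_mul := AnnulusRing.one_mul
    mul_one := fun f => by rw [AnnulusRing.mul_comm, AnnulusRing.one_mul]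
    right_distrib := AnnulusRing.add_mul
    left_distrib := fun f g h => by
      simp only [AnnulusRing.mul_comm f, AnnulusRing.add_mul]
    zero_mul := fun f => by
      ext n
      simp [coeff_mul]
    mul_zero := fun f => by
      ext n
      simp [coeff_mul] }

/-- A nonzero series has a last index at which its Gauss norm is attained. -/
theorem exists_dominant (f : AnnulusRing F α) (hf : f ≠ 0) :
    ∃ i : ℤ, f.coeff i ≠ 0 ∧
      (∀ j, ‖f.coeff j‖ * (α : ℝ) ^ j ≤ ‖f.coeff i‖ * (α : ℝ) ^ i) ∧
      ∀ j, i < j → ‖f.coeff j‖ * (α : ℝ) ^ j < ‖f.coeff i‖ * (α : ℝ) ^ i := by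
  have hα : 0 < (α : ℝ) := α.2.1
  obtain ⟨m, hm⟩ : ∃ m, f.coeff m ≠ 0 := by
    by_contra! h
    exact hf (AnnulusRing.ext fun k => h k)
  have large : ∀ c : ℝ, 0 < c → {j : ℤ | c ≤ ‖f.coeff j‖ * (α : ℝ) ^ j}.Finite := by
    intro c hc
    have h := (f.tendsto (self_mem α)).eventually (gt_mem_nhds hc)
    refine Set.Finite.subset h fun j hj => ?_
    exact not_lt.2 (show c ≤ _ from hj)
  have hm0 : 0 < ‖f.coeff m‖ * (α : ℝ) ^ m := by positivity
  obtain ⟨k, hk, hkmax⟩ := Set.exists_max_image _ (fun j => ‖f.coeff j‖ * (α : ℝ) ^ j)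
    (large _ hm0) ⟨m, le_refl (‖f.coeff m‖ * (α : ℝ) ^ m)⟩
  have hk' : ∀ j, ‖f.coeff j‖ * (α : ℝ) ^ j ≤ ‖f.coeff k‖ * (α : ℝ) ^ k := by
    intro j
    by_cases hj : ‖f.coeff m‖ * (α : ℝ) ^ m ≤ ‖f.coeff j‖ * (α : ℝ) ^ j
    · exact hkmax j hj
    · exact (not_le.1 hj).le.trans hk
  have hk0 : 0 < ‖f.coeff k‖ * (α : ℝ) ^ k := hm0.trans_le hk
  obtain ⟨i, hi, himax⟩ := Set.exists_max_image _ (fun j : ℤ => j) (large _ hk0) ⟨k, le_refl (‖f.coeff k‖ * (α : ℝ) ^ k)⟩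
  refine ⟨i, ?_, fun j => (hk' j).trans hi, fun j hij => ?_⟩
  · intro h
    have : ‖f.coeff k‖ * (α : ℝ) ^ k ≤ ‖f.coeff i‖ * (α : ℝ) ^ i := hi
    rw [h, norm_zero, zero_mul] at this
    exact absurd this (not_le.2 hk0)
  · by_contra h
    exact absurd (himax j (le_trans hi (not_lt.1 h))) (not_le.2 hij)

instance : Nontrivial (AnnulusRing F α) :=
  ⟨0, 1, fun h => by
    have := congrArg (fun f : AnnulusRing F α => f.coeff 0) h
    simp [coeff_one] at this⟩

instance : NoZeroDivisors (AnnulusRing F α) where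
  eq_zero_or_eq_zero_of_mul_eq_zero := by
    intro f g hfg
    by_contra! hne
    have hα : 0 < (α : ℝ) := α.2.1
    obtain ⟨i, hi, hi1, hi2⟩ := exists_dominant f hne.1
    obtain ⟨j, hj, hj1, hj2⟩ := exists_dominant g hne.2
    set n := i + j with hn
    have hlt : ∀ k, k ≠ i →
        ‖f.coeff k * g.coeff (n - k)‖ < ‖f.coeff i * g.coeff j‖ := by
      intro k hk
      have e : (α : ℝ) ^ k * (α : ℝ) ^ (n - k) = (α : ℝ) ^ i * (α : ℝ) ^ j := by
        rw [← zpow_add₀ hα.ne', ← zpow_add₀ hα.ne']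
        congr 1
        omega
      have hA : 0 < ‖f.coeff i‖ * (α : ℝ) ^ i := by positivity
      have hB : 0 < ‖g.coeff j‖ * (α : ℝ) ^ j := by positivity
      have key : (‖f.coeff k‖ * (α : ℝ) ^ k) * (‖g.coeff (n - k)‖ * (α : ℝ) ^ (n - k)) <
          (‖f.coeff i‖ * (α : ℝ) ^ i) * (‖g.coeff j‖ * (α : ℝ) ^ j) := by
        rcases lt_or_gt_of_ne hk with h | h
        · exact mul_lt_mul' (hi1 k) (hj2 _ (by omega)) (by positivity) hA
        · exact (mul_le_mul_of_nonneg_left (hj1 _) (by positivity)).trans_lt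
            (mul_lt_mul_of_pos_right (hi2 k h) hB)
      rw [norm_mul, norm_mul]
      refine lt_of_mul_lt_mul_right (a := (α : ℝ) ^ i * (α : ℝ) ^ j) ?_ (by positivity)
      calc _ = (‖f.coeff k‖ * (α : ℝ) ^ k) * (‖g.coeff (n - k)‖ * (α : ℝ) ^ (n - k)) := by
            rw [← e]
            ring
        _ < _ := key
        _ = _ := by ring
    set c : ℝ := ‖f.coeff i * g.coeff j‖ with hc
    have hc0 : 0 < c := norm_pos_iff.2 (mul_ne_zero hi hj)
    obtain ⟨c', hc'0, hc'c, hc'⟩ : ∃ c' : ℝ, 0 ≤ c' ∧ c' < c ∧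
        ∀ k, k ≠ i → ‖f.coeff k * g.coeff (n - k)‖ ≤ c' := by
      have hfin : {k : ℤ | ¬ ‖f.coeff k * g.coeff (n - k)‖ < c / 2}.Finite :=
        (tendsto_zero_iff_norm_tendsto_zero.1 (tendsto_conv f g n)).eventually
          (gt_mem_nhds (half_pos hc0))
      have hfin' := hfin.subset (Set.sdiff_subset (t := {i}))
      rcases Set.eq_empty_or_nonempty ({k : ℤ | ¬ ‖f.coeff k * g.coeff (n - k)‖ < c / 2} \ {i})
        with h | h
      · refine ⟨c / 2, (half_pos hc0).le, half_lt_self hc0, fun k hk => ?_⟩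
        by_contra hcon
        exact Set.eq_empty_iff_forall_notMem.1 h k ⟨fun h' => hcon h'.le, hk⟩
      · obtain ⟨m, hm, hmax⟩ := Set.exists_max_image _
          (fun k : ℤ => ‖f.coeff k * g.coeff (n - k)‖) hfin' h
        refine ⟨_, norm_nonneg _, hlt m hm.2, fun k hk => ?_⟩
        by_cases hk2 : ‖f.coeff k * g.coeff (n - k)‖ < c / 2
        · exact hk2.le.trans (not_lt.1 hm.1)
        · exact hmax k ⟨hk2, hk⟩
    have h0 : (f * g).coeff n = 0 := by rw [hfg, coeff_zero]
    rw [coeff_mul, (summable_conv f g n).tsum_eq_add_tsum_ite i,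
      show n - i = j by omega] at h0
    have h1 : ‖∑' k, ite (k = i) 0 (f.coeff k * g.coeff (n - k))‖ ≤ c' := by
      refine IsUltrametricDist.norm_tsum_le_of_forall_le_of_nonneg hc'0 fun k => ?_
      split_ifs with hk
      · simpa using hc'0
      · exact hc' k hk
    rw [← neg_eq_of_add_eq_zero_right h0, norm_neg] at h1
    exact absurd h1 (not_le.2 hc'c)

instance : IsDomain (AnnulusRing F α) := NoZeroDivisors.to_isDomain _

/-- The topology on a free module of finite rank over the ring of analytic functions on the
annulus that is given by a basis: the product topology of `(AnnulusRing F α)^ι`, transported by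
the coordinates. -/
@[reducible]
def basisTopology {ι M : Type*} [Fintype ι] [AddCommGroup M] [Module (AnnulusRing F α) M]
    (b : Module.Basis ι (AnnulusRing F α) M) : TopologicalSpace M :=
  TopologicalSpace.induced b.equivFun inferInstance

end AnnulusRing
end

noncomputable section

/-! Induct on `d`. The elements of `N` with zero first coordinate form a closed submodule of
`R^(d-1)`, free by induction. If the ideal `I` of first coordinates is generated by `y 0` for some
`y ∈ N`, then `N` is the direct sum of that submodule and `R y`. Ranks survive base change to the
fraction field, which gives both assertions. The work is to show that a nonzero `I` is principal,
although the image of a closed submodule is not obviously closed.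

The closure of `I` is principal. On a closed annulus `α ≤ |T| ≤ r`, the distance from the least
dominant index at `α` to the greatest one at `r` counts the zeros of a series and plays the role of
a Euclidean degree. Division with remainder shows that an element of `I` of least width generates
`I` up to closure there (`exists_mem_forall_approxDvd`). For two radii `r ≤ r'`, the two generators
differ on the smaller annulus, up to a small error, by a factor without zeros `c T^k (1 + h)` with
`|h| < 1`. As the valuation is discrete, the low-degree part of `1 + h` is a unit of the whole ring,
and the rest is very close to `1` well inside the annulus (`exists_unit_mul_one_add`). Dividing out
these units makes the generators converge as `r → 1` to some `g` which divides all of `I` and lies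
in its closure (`exists_generator_of_closure`).

The generator `g` is attained on `N`. On each annulus there are elements of `N` with first
coordinate `g (1 - s)`, where `s` is as small as desired while the elements stay bounded
(`exists_bounded_approx`). Correcting the error repeatedly gives a convergent sequence in `N`; its
limit lies in `N` by closedness and has first coordinate `g`. -/

theorem norm_tsum_lt_of_tendsto_cofinite {F : Type*} [NormedField F] [IsUltrametricDist F]
    {ι : Type*} {u : ι → F} {c : ℝ} (hc : 0 < c) (hu : Tendsto u cofinite (𝓝 0))
    (h : ∀ i, ‖u i‖ < c) : ‖∑' i, u i‖ < c := by
  -- Only finitely many terms reach `c / 2`, so the supremum is either at most `c / 2` or attained;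
  -- this keeps the inequality strict.
  have hfin : {i | ¬ ‖u i‖ < c / 2}.Finite :=
    (tendsto_zero_iff_norm_tendsto_zero.1 hu).eventually (gt_mem_nhds (half_pos hc))
  rcases Set.eq_empty_or_nonempty {i | ¬ ‖u i‖ < c / 2} with h0 | h0
  · refine lt_of_le_of_lt (IsUltrametricDist.norm_tsum_le_of_forall_le_of_nonneg
      (half_pos hc).le fun i => ?_) (half_lt_self hc)
    by_contra hi
    exact Set.eq_empty_iff_forall_notMem.1 h0 i fun h' => hi h'.le
  · obtain ⟨m, hm, hmax⟩ := Set.exists_max_image _ (fun i => ‖u i‖) hfin h0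
    refine lt_of_le_of_lt (IsUltrametricDist.norm_tsum_le_of_forall_le_of_nonneg
      (norm_nonneg (u m)) fun i => ?_) (h m)
    by_cases hi : ‖u i‖ < c / 2
    · exact hi.le.trans (not_lt.1 hm)
    · exact hmax i hi

theorem norm_tsum_eq_of_forall_ne_lt {F : Type*} [NormedField F] [IsUltrametricDist F]
    [CompleteSpace F] {ι : Type*} {u : ι → F} {i : ι} (hi : u i ≠ 0)
    (hu : Tendsto u cofinite (𝓝 0)) (h : ∀ k, k ≠ i → ‖u k‖ < ‖u i‖) :
    ‖∑' k, u k‖ = ‖u i‖ := by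
  classical
  have hs : Summable u := NonarchimedeanAddGroup.summable_of_tendsto_cofinite_zero hu
  have hi0 : 0 < ‖u i‖ := norm_pos_iff.2 hi
  have hlt : ‖∑' k, ite (k = i) 0 (u k)‖ < ‖u i‖ := by
    refine norm_tsum_lt_of_tendsto_cofinite hi0 ?_ fun k => ?_
    · refine squeeze_zero_norm (fun k => ?_) (tendsto_zero_iff_norm_tendsto_zero.1 hu)
      split_ifs <;> simp
    · split_ifs with hk
      · simpa using hi
      · exact h k hk
  rw [hs.tsum_eq_add_tsum_ite i, IsUltrametricDist.norm_add_eq_max_of_norm_ne_norm hlt.ne',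
    max_eq_left hlt.le]

namespace AnnulusRing

/-! ### Gauss norms -/

section Norm

variable {F : Type*} [NormedField F] {α : Set.Ioo (0 : ℝ) 1}

@[simp] theorem coeff_sub (f g : AnnulusRing F α) (k : ℤ) :
    (f - g).coeff k = f.coeff k - g.coeff k := rfl

/-- The inner radius of the annulus. -/
def inner (α : Set.Ioo (0 : ℝ) 1) : Set.Ico (α : ℝ) 1 := ⟨α, self_mem α⟩

theorem inner_le (ρ : Set.Ico (α : ℝ) 1) : inner α ≤ ρ := ρ.2.1

theorem radius_pos (ρ : Set.Ico (α : ℝ) 1) : 0 < (ρ : ℝ) := pos_of_mem ρ.2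

theorem radius_lt_one (ρ : Set.Ico (α : ℝ) 1) : (ρ : ℝ) < 1 := ρ.2.2

/-- The Gauss norm `|f|_ρ`. -/
def gaussNorm (ρ : Set.Ico (α : ℝ) 1) (f : AnnulusRing F α) : ℝ := gaussSeminorm F α ρ f

theorem le_gaussNorm (ρ : Set.Ico (α : ℝ) 1) (f : AnnulusRing F α) (k : ℤ) :
    ‖f.coeff k‖ * (ρ : ℝ) ^ k ≤ gaussNorm ρ f :=
  le_ciSup (f.bddAbove ρ.2) k

theorem gaussNorm_le {ρ : Set.Ico (α : ℝ) 1} {f : AnnulusRing F α} {c : ℝ}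
    (h : ∀ k, ‖f.coeff k‖ * (ρ : ℝ) ^ k ≤ c) : gaussNorm ρ f ≤ c :=
  ciSup_le h

theorem gaussNorm_nonneg (ρ : Set.Ico (α : ℝ) 1) (f : AnnulusRing F α) : 0 ≤ gaussNorm ρ f :=
  apply_nonneg _ _

@[simp] theorem gaussNorm_zero (ρ : Set.Ico (α : ℝ) 1) :
    gaussNorm ρ (0 : AnnulusRing F α) = 0 := map_zero _

@[simp] theorem gaussNorm_neg (ρ : Set.Ico (α : ℝ) 1) (f : AnnulusRing F α) :
    gaussNorm ρ (-f) = gaussNorm ρ f := map_neg_eq_map _ _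

theorem gaussNorm_sub_comm (ρ : Set.Ico (α : ℝ) 1) (f g : AnnulusRing F α) :
    gaussNorm ρ (f - g) = gaussNorm ρ (g - f) := map_sub_rev _ _ _

theorem gaussNorm_pos {f : AnnulusRing F α} (hf : f ≠ 0) (ρ : Set.Ico (α : ℝ) 1) :
    0 < gaussNorm ρ f := by
  obtain ⟨m, hm⟩ : ∃ m, f.coeff m ≠ 0 := by
    by_contra! h
    exact hf (AnnulusRing.ext fun k => h k)
  have := radius_pos ρ
  exact lt_of_lt_of_le (by positivity) (le_gaussNorm ρ f m)

theorem eq_zero_of_gaussNorm_lt {f : AnnulusRing F α} (ρ : Set.Ico (α : ℝ) 1)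
    (h : ∀ ε > 0, gaussNorm ρ f < ε) : f = 0 := by
  by_contra hf
  exact lt_irrefl _ (h _ (gaussNorm_pos hf ρ))

theorem zpow_le_max {a x r : ℝ} (ha : 0 < a) (hax : a ≤ x) (hxr : x ≤ r) (k : ℤ) :
    x ^ k ≤ max (a ^ k) (r ^ k) := by
  rcases le_total 0 k with hk | hk
  · exact le_max_of_le_right (zpow_le_zpow_left₀ hk (ha.le.trans hax) hxr)
  · refine le_max_of_le_left ?_
    obtain ⟨n, rfl⟩ : ∃ n : ℕ, k = -(n : ℤ) := ⟨k.natAbs, by omega⟩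
    rw [zpow_neg, zpow_neg, zpow_natCast, zpow_natCast]
    exact inv_anti₀ (pow_pos ha n) (pow_le_pow_left₀ ha.le hax n)

/-- Maximum principle: `ρ ^ k` is monotone in `ρ` for each `k`, so every term is largest at an end
of `[α, r]`. Uniform estimates on a closed annulus thus reduce to two radii. -/
theorem gaussNorm_le_max {ρ r : Set.Ico (α : ℝ) 1} (h : ρ ≤ r) (f : AnnulusRing F α) :
    gaussNorm ρ f ≤ max (gaussNorm (inner α) f) (gaussNorm r f) := by
  refine gaussNorm_le fun k => ?_
  refine (mul_le_mul_of_nonneg_left (zpow_le_max (radius_pos (inner α)) (inner_le ρ) h k)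
    (norm_nonneg _)).trans ?_
  rw [mul_max_of_nonneg _ _ (norm_nonneg _)]
  exact max_le_max (le_gaussNorm _ _ _) (le_gaussNorm _ _ _)

/-- One nonzero coefficient suffices, since `ρ ^ k` stays above `min (α ^ k) 1`. The bound converts
absolute errors into relative ones uniformly in the radius. -/
theorem exists_forall_le_gaussNorm {f : AnnulusRing F α} (hf : f ≠ 0) :
    ∃ m : ℝ, 0 < m ∧ ∀ ρ, m ≤ gaussNorm ρ f := by
  obtain ⟨k, hk⟩ : ∃ m, f.coeff m ≠ 0 := by
    by_contra! h
    exact hf (AnnulusRing.ext fun k => h k)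
  have hα := radius_pos (inner α)
  refine ⟨‖f.coeff k‖ * min ((inner α : ℝ) ^ k) 1, by positivity, fun ρ =>
    le_trans (mul_le_mul_of_nonneg_left ?_ (norm_nonneg _)) (le_gaussNorm ρ f k)⟩
  rcases le_total 0 k with h | h
  · exact min_le_of_left_le (zpow_le_zpow_left₀ h hα.le (inner_le ρ))
  · exact min_le_of_right_le (one_le_zpow_of_nonpos₀ (radius_pos ρ) (radius_lt_one ρ).le h)

variable [IsUltrametricDist F]

theorem gaussNorm_add_le (ρ : Set.Ico (α : ℝ) 1) (f g : AnnulusRing F α) :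
    gaussNorm ρ (f + g) ≤ max (gaussNorm ρ f) (gaussNorm ρ g) := by
  have := radius_pos ρ
  refine gaussNorm_le fun k => ?_
  rw [coeff_add]
  refine (mul_le_mul_of_nonneg_right (IsUltrametricDist.norm_add_le_max _ _)
    (by positivity)).trans ?_
  rw [max_mul_of_nonneg _ _ (by positivity)]
  exact max_le_max (le_gaussNorm _ _ _) (le_gaussNorm _ _ _)

theorem gaussNorm_sub_le (ρ : Set.Ico (α : ℝ) 1) (f g : AnnulusRing F α) :
    gaussNorm ρ (f - g) ≤ max (gaussNorm ρ f) (gaussNorm ρ g) := by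
  rw [sub_eq_add_neg, ← gaussNorm_neg ρ g]
  exact gaussNorm_add_le ρ f (-g)

theorem gaussNorm_sub_lt {ρ : Set.Ico (α : ℝ) 1} {f g h : AnnulusRing F α} {c : ℝ}
    (h₁ : gaussNorm ρ (f - g) < c) (h₂ : gaussNorm ρ (g - h) < c) : gaussNorm ρ (f - h) < c := by
  rw [← sub_add_sub_cancel f g h]
  exact (gaussNorm_add_le _ _ _).trans_lt (max_lt h₁ h₂)

theorem gaussNorm_eq_of_sub_lt {ρ : Set.Ico (α : ℝ) 1} {f g : AnnulusRing F α}
    (h : gaussNorm ρ (f - g) < gaussNorm ρ g) : gaussNorm ρ f = gaussNorm ρ g := by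
  apply le_antisymm
  · have := gaussNorm_add_le ρ (f - g) g
    rw [sub_add_cancel] at this
    exact this.trans (max_le h.le le_rfl)
  · by_contra! hlt
    have := gaussNorm_sub_le ρ f (f - g)
    rw [sub_sub_cancel] at this
    exact absurd this (not_le.2 (max_lt hlt h))

end Norm

/-! ### Dominant indices and multiplicativity of the Gauss norms -/

section Dominant

variable {F : Type*} [NormedField F] {α : Set.Ioo (0 : ℝ) 1}

/-- The index `i` realises the Gauss norm of `f` at the radius `ρ`, and it is the last such index
in the direction of `σ` (the greatest for `σ = 1`, the least for `σ = -1`). -/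
def IsDominant (σ : ℤ) (ρ : Set.Ico (α : ℝ) 1) (f : AnnulusRing F α) (i : ℤ) : Prop :=
  f.coeff i ≠ 0 ∧ (∀ j, ‖f.coeff j‖ * (ρ : ℝ) ^ j ≤ ‖f.coeff i‖ * (ρ : ℝ) ^ i) ∧
    ∀ j, 0 < σ * (j - i) → ‖f.coeff j‖ * (ρ : ℝ) ^ j < ‖f.coeff i‖ * (ρ : ℝ) ^ i

theorem exists_isDominant (σ : ℤ) (ρ : Set.Ico (α : ℝ) 1) {f : AnnulusRing F α} (hf : f ≠ 0) :
    ∃ i, IsDominant σ ρ f i := by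
  have hρ := radius_pos ρ
  obtain ⟨m, hm⟩ : ∃ m, f.coeff m ≠ 0 := by
    by_contra! h
    exact hf (AnnulusRing.ext fun k => h k)
  have large : ∀ c : ℝ, 0 < c → {j : ℤ | c ≤ ‖f.coeff j‖ * (ρ : ℝ) ^ j}.Finite := by
    intro c hc
    refine Set.Finite.subset ((f.tendsto ρ.2).eventually (gt_mem_nhds hc)) fun j hj => ?_
    exact not_lt.2 (show c ≤ _ from hj)
  have hm0 : 0 < ‖f.coeff m‖ * (ρ : ℝ) ^ m := by positivity
  obtain ⟨k, hk, hkmax⟩ := Set.exists_max_image _ (fun j => ‖f.coeff j‖ * (ρ : ℝ) ^ j)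
    (large _ hm0) ⟨m, le_refl (‖f.coeff m‖ * (ρ : ℝ) ^ m)⟩
  have hk' : ∀ j, ‖f.coeff j‖ * (ρ : ℝ) ^ j ≤ ‖f.coeff k‖ * (ρ : ℝ) ^ k := by
    intro j
    by_cases hj : ‖f.coeff m‖ * (ρ : ℝ) ^ m ≤ ‖f.coeff j‖ * (ρ : ℝ) ^ j
    · exact hkmax j hj
    · exact (not_le.1 hj).le.trans hk
  have hk0 : 0 < ‖f.coeff k‖ * (ρ : ℝ) ^ k := hm0.trans_le hk
  obtain ⟨i, hi, himax⟩ := Set.exists_max_image _ (fun j : ℤ => σ * j) (large _ hk0)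
    ⟨k, le_refl (‖f.coeff k‖ * (ρ : ℝ) ^ k)⟩
  have hi' : ‖f.coeff k‖ * (ρ : ℝ) ^ k ≤ ‖f.coeff i‖ * (ρ : ℝ) ^ i := hi
  refine ⟨i, ?_, fun j => (hk' j).trans hi, fun j hij => ?_⟩
  · intro h
    rw [h, norm_zero, zero_mul] at hi'
    exact absurd hi' (not_le.2 hk0)
  · by_contra h
    have := himax j (le_trans hi (not_lt.1 h))
    rw [mul_sub] at hij
    omega

namespace IsDominant

variable {σ : ℤ} {ρ r : Set.Ico (α : ℝ) 1} {f g : AnnulusRing F α} {i j : ℤ}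

theorem gaussNorm_eq (h : IsDominant σ ρ f i) : gaussNorm ρ f = ‖f.coeff i‖ * (ρ : ℝ) ^ i :=
  le_antisymm (gaussNorm_le h.2.1) (le_gaussNorm _ _ _)

theorem lt_gaussNorm (h : IsDominant σ ρ f i) (hj : 0 < σ * (j - i)) :
    ‖f.coeff j‖ * (ρ : ℝ) ^ j < gaussNorm ρ f := by
  rw [h.gaussNorm_eq]
  exact h.2.2 j hj

theorem unique (hσ : σ ≠ 0) (hi : IsDominant σ ρ f i) (hj : IsDominant σ ρ f j) : i = j := by
  rcases lt_trichotomy (σ * (j - i)) 0 with h | h | h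
  · exact absurd (hi.2.1 j) (not_le.2 (hj.2.2 i (by linarith)))
  · rcases mul_eq_zero.1 h with h | h
    · exact absurd h hσ
    · omega
  · exact absurd (hj.2.1 i) (not_le.2 (hi.2.2 j h))

/-- Passing from `ρ` to `r` multiplies the weight of index `k` by `(r / ρ) ^ k`, which favours large
indices, so dominant indices can only move up. -/
theorem first_le_last (h : ρ ≤ r) (hi : IsDominant (-1) ρ f i) (hj : IsDominant 1 r f j) :
    i ≤ j := by
  by_contra! hlt
  have hρ := radius_pos ρ
  have hr := radius_pos r
  have h1 := hi.2.2 j (by omega)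
  have h2 := hj.2.2 i (by omega)
  have hq : 1 ≤ (r : ℝ) / ρ := (one_le_div hρ).2 h
  have h3 : ((r : ℝ) / ρ) ^ j ≤ ((r : ℝ) / ρ) ^ i := zpow_le_zpow_right₀ hq hlt.le
  have e : ∀ k : ℤ, (r : ℝ) ^ k = (ρ : ℝ) ^ k * ((r : ℝ) / ρ) ^ k := by
    intro k
    rw [← mul_zpow, mul_div_cancel₀ _ hρ.ne']
  rw [e, e, ← mul_assoc, ← mul_assoc] at h2
  refine absurd h2 (not_lt.2 (mul_le_mul h1.le h3 (by positivity) (by positivity)))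

variable [IsUltrametricDist F]

theorem of_sub_lt (h : IsDominant σ ρ f i) (hfg : gaussNorm ρ (g - f) < gaussNorm ρ f) :
    IsDominant σ ρ g i := by
  have hρ := radius_pos ρ
  have e : ‖g.coeff i‖ = ‖f.coeff i‖ := by
    have h1 : ‖(g - f).coeff i‖ < ‖f.coeff i‖ := by
      refine lt_of_mul_lt_mul_right (a := (ρ : ℝ) ^ i) ?_ (by positivity)
      rw [← h.gaussNorm_eq]
      exact (le_gaussNorm ρ _ i).trans_lt hfg
    rw [show g.coeff i = (g - f).coeff i + f.coeff i by simp,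
      IsUltrametricDist.norm_add_eq_max_of_norm_ne_norm h1.ne, max_eq_right h1.le]
  have en := gaussNorm_eq_of_sub_lt hfg
  refine ⟨fun h0 => h.1 ?_, fun j => ?_, fun j hj => ?_⟩
  · rw [h0, norm_zero] at e
    exact norm_eq_zero.1 e.symm
  · rw [e, ← h.gaussNorm_eq, ← en]
    exact le_gaussNorm _ _ _
  · rw [e, ← h.gaussNorm_eq]
    have h1 : ‖g.coeff j‖ ≤ max ‖(g - f).coeff j‖ ‖f.coeff j‖ := by
      rw [show g.coeff j = (g - f).coeff j + f.coeff j by simp]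
      exact IsUltrametricDist.norm_add_le_max _ _
    refine (mul_le_mul_of_nonneg_right h1 (zpow_pos hρ j).le).trans_lt ?_
    rw [max_mul_of_nonneg _ _ (zpow_pos hρ j).le]
    exact max_lt ((le_gaussNorm ρ _ j).trans_lt hfg) (h.lt_gaussNorm hj)

end IsDominant

theorem isDominant_one (σ : ℤ) (ρ : Set.Ico (α : ℝ) 1) :
    IsDominant σ ρ (1 : AnnulusRing F α) 0 := by
  refine ⟨by simp [coeff_one], fun j => ?_, fun j hj => ?_⟩
  · rw [coeff_one]
    split_ifs with h
    · simp [h, coeff_one]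
    · simp [coeff_one]
  · have h : j ≠ 0 := by
      rintro rfl
      simp at hj
    simp [coeff_one, h]

@[simp] theorem gaussNorm_one (ρ : Set.Ico (α : ℝ) 1) :
    gaussNorm ρ (1 : AnnulusRing F α) = 1 := by
  rw [(isDominant_one 1 ρ).gaussNorm_eq]
  simp [coeff_one]

variable [IsUltrametricDist F]

theorem zpow_mul_zpow_sub (ρ : Set.Ico (α : ℝ) 1) (k n : ℤ) :
    (ρ : ℝ) ^ k * (ρ : ℝ) ^ (n - k) = (ρ : ℝ) ^ n := by
  rw [← zpow_add₀ (radius_pos ρ).ne', add_sub_cancel]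

theorem gaussNorm_mul_le (ρ : Set.Ico (α : ℝ) 1) (f g : AnnulusRing F α) :
    gaussNorm ρ (f * g) ≤ gaussNorm ρ f * gaussNorm ρ g := by
  have hρ := radius_pos ρ
  have h0 := mul_nonneg (gaussNorm_nonneg ρ f) (gaussNorm_nonneg ρ g)
  refine gaussNorm_le fun n => ?_
  rw [← le_div_iff₀ (zpow_pos hρ n), coeff_mul]
  refine IsUltrametricDist.norm_tsum_le_of_forall_le_of_nonneg (by positivity) fun k => ?_
  rw [le_div_iff₀ (zpow_pos hρ n), norm_mul, ← zpow_mul_zpow_sub ρ k, mul_mul_mul_comm]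
  exact mul_le_mul (le_gaussNorm _ _ _) (le_gaussNorm _ _ _) (by positivity)
    (gaussNorm_nonneg _ _)

variable [CompleteSpace F]

/-- Any pair of indices with sum `i + j` other than `(i, j)` has one member strictly beyond the
dominant one in the direction `σ`. The product `aᵢ bⱼ` is therefore strictly the largest term of the
convolution. -/
theorem IsDominant.norm_coeff_mul {σ : ℤ} (hσ : σ ≠ 0) {ρ : Set.Ico (α : ℝ) 1}
    {f g : AnnulusRing F α} {i j : ℤ} (hf : IsDominant σ ρ f i) (hg : IsDominant σ ρ g j) :
    ‖(f * g).coeff (i + j)‖ = ‖f.coeff i‖ * ‖g.coeff j‖ := by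
  have hρ := radius_pos ρ
  have hf0 := norm_pos_iff.2 hf.1
  have hg0 := norm_pos_iff.2 hg.1
  have ej : i + j - i = j := by ring
  rw [coeff_mul, norm_tsum_eq_of_forall_ne_lt (i := i), ej, norm_mul]
  · rw [ej]
    exact mul_ne_zero hf.1 hg.1
  · exact tendsto_conv f g _
  · intro k hk
    rw [ej, norm_mul, norm_mul]
    refine lt_of_mul_lt_mul_right (a := (ρ : ℝ) ^ (i + j)) ?_ (by positivity)
    have e : ‖f.coeff k‖ * ‖g.coeff (i + j - k)‖ * (ρ : ℝ) ^ (i + j) =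
        ‖f.coeff k‖ * (ρ : ℝ) ^ k * (‖g.coeff (i + j - k)‖ * (ρ : ℝ) ^ (i + j - k)) := by
      rw [← zpow_mul_zpow_sub ρ k (i + j), mul_mul_mul_comm]
    rw [e, zpow_add₀ hρ.ne', mul_mul_mul_comm ‖f.coeff i‖]
    rcases lt_trichotomy (σ * (k - i)) 0 with h | h | h
    · refine mul_lt_mul' (hf.2.1 k) (hg.2.2 _ ?_) (by positivity) (by positivity)
      linarith
    · exact absurd h (mul_ne_zero hσ (by omega))
    · exact (mul_le_mul_of_nonneg_left (hg.2.1 _) (by positivity)).trans_lt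
        (mul_lt_mul_of_pos_right (hf.2.2 k h) (by positivity))

theorem gaussNorm_mul (ρ : Set.Ico (α : ℝ) 1) (f g : AnnulusRing F α) :
    gaussNorm ρ (f * g) = gaussNorm ρ f * gaussNorm ρ g := by
  rcases eq_or_ne f 0 with rfl | hf
  · simp
  rcases eq_or_ne g 0 with rfl | hg
  · simp
  obtain ⟨i, hi⟩ := exists_isDominant 1 ρ hf
  obtain ⟨j, hj⟩ := exists_isDominant 1 ρ hg
  refine le_antisymm (gaussNorm_mul_le ρ f g) ?_
  have h := le_gaussNorm ρ (f * g) (i + j)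
  rwa [hi.norm_coeff_mul one_ne_zero hj, zpow_add₀ (radius_pos ρ).ne', mul_mul_mul_comm,
    ← hi.gaussNorm_eq, ← hj.gaussNorm_eq] at h

/-- Extremal dominant indices add, as degrees do. This is what forces approximately invertible
factors to have width zero. -/
theorem IsDominant.mul {σ : ℤ} (hσ : σ ≠ 0) {ρ : Set.Ico (α : ℝ) 1}
    {f g : AnnulusRing F α} {i j : ℤ} (hf : IsDominant σ ρ f i) (hg : IsDominant σ ρ g j) :
    IsDominant σ ρ (f * g) (i + j) := by
  have hρ := radius_pos ρ
  have hf0 := norm_pos_iff.2 hf.1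
  have hg0 := norm_pos_iff.2 hg.1
  have e : ‖(f * g).coeff (i + j)‖ * (ρ : ℝ) ^ (i + j) = gaussNorm ρ f * gaussNorm ρ g := by
    rw [hf.norm_coeff_mul hσ hg, hf.gaussNorm_eq, hg.gaussNorm_eq, zpow_add₀ hρ.ne']
    ring
  refine ⟨norm_pos_iff.1 ?_, fun n => ?_, fun n hn => ?_⟩
  · rw [hf.norm_coeff_mul hσ hg]
    positivity
  · rw [e, ← gaussNorm_mul]
    exact le_gaussNorm _ _ _
  · rw [e, ← lt_div_iff₀ (zpow_pos hρ n), coeff_mul]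
    have hf1 : 0 < gaussNorm ρ f := by rw [hf.gaussNorm_eq]; positivity
    have hg1 : 0 < gaussNorm ρ g := by rw [hg.gaussNorm_eq]; positivity
    refine norm_tsum_lt_of_tendsto_cofinite (by positivity) (tendsto_conv f g n) fun k => ?_
    rw [lt_div_iff₀ (zpow_pos hρ n), norm_mul, ← zpow_mul_zpow_sub ρ k, mul_mul_mul_comm]
    rcases le_or_gt (σ * (k - i)) 0 with h | h
    · refine mul_lt_mul' (le_gaussNorm _ _ _) (hg.lt_gaussNorm ?_) (by positivity) hf1
      linarith
    · exact (mul_le_mul_of_nonneg_left (le_gaussNorm _ _ _) (by positivity)).trans_lt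
        (mul_lt_mul_of_pos_right (hf.lt_gaussNorm h) hg1)

@[simp] theorem gaussNorm_pow (ρ : Set.Ico (α : ℝ) 1) (f : AnnulusRing F α) (n : ℕ) :
    gaussNorm ρ (f ^ n) = gaussNorm ρ f ^ n := by
  induction n with
  | zero => simp
  | succ n ih => rw [pow_succ, gaussNorm_mul, ih, pow_succ]

end Dominant

/-! ### Truncations and monomials -/

section Truncation

variable {F : Type*} [NormedField F] {α : Set.Ioo (0 : ℝ) 1}

open Classical in
/-- The part of a Laurent series that is supported in `S`. -/
def trunc (S : Set ℤ) (f : AnnulusRing F α) : AnnulusRing F α :=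
  ⟨fun k => if k ∈ S then f.coeff k else 0, by
    intro ρ hρ
    have hρ0 : 0 < ρ := pos_of_mem hρ
    refine squeeze_zero (fun k => by positivity) (fun k => ?_) (f.tendsto hρ)
    refine mul_le_mul_of_nonneg_right ?_ (by positivity)
    dsimp only
    split_ifs <;> simp⟩

open Classical in
theorem coeff_trunc (S : Set ℤ) (f : AnnulusRing F α) (k : ℤ) :
    (trunc S f).coeff k = if k ∈ S then f.coeff k else 0 := rfl

theorem coeff_trunc_of_mem {S : Set ℤ} (f : AnnulusRing F α) {k : ℤ} (h : k ∈ S) :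
    (trunc S f).coeff k = f.coeff k := by
  rw [coeff_trunc, if_pos h]

theorem coeff_trunc_of_notMem {S : Set ℤ} (f : AnnulusRing F α) {k : ℤ} (h : k ∉ S) :
    (trunc S f).coeff k = 0 := by
  rw [coeff_trunc, if_neg h]

theorem gaussNorm_trunc_le (ρ : Set.Ico (α : ℝ) 1) (S : Set ℤ) (f : AnnulusRing F α) :
    gaussNorm ρ (trunc S f) ≤ gaussNorm ρ f := by
  refine gaussNorm_le fun k => ?_
  rw [coeff_trunc]
  split_ifs
  · exact le_gaussNorm _ _ _
  · simpa using gaussNorm_nonneg ρ f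

theorem exists_forall_gaussNorm_sub_trunc_le (ρ : Set.Ico (α : ℝ) 1) (f : AnnulusRing F α)
    {ε : ℝ} (hε : 0 < ε) :
    ∃ m : ℕ, ∀ S : Set ℤ, (∀ k : ℤ, |k| ≤ m → k ∈ S) → gaussNorm ρ (f - trunc S f) ≤ ε := by
  have hfin : {k : ℤ | ¬ ‖f.coeff k‖ * (ρ : ℝ) ^ k < ε}.Finite :=
    (f.tendsto ρ.2).eventually (gt_mem_nhds hε)
  obtain ⟨m, hm⟩ := (hfin.image fun k => k.natAbs).bddAbove
  refine ⟨m, fun S hS => gaussNorm_le fun k => ?_⟩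
  rw [coeff_sub]
  by_cases hk : k ∈ S
  · rw [coeff_trunc_of_mem f hk]
    simpa using hε.le
  · rw [coeff_trunc_of_notMem f hk, sub_zero]
    by_contra hcon
    have h1 : k.natAbs ≤ m := hm ⟨k, fun h => hcon h.le, rfl⟩
    exact hk (hS k (by rw [Int.abs_eq_natAbs]; omega))

/-- The monomial `c Tᵏ`. -/
def monomial (k : ℤ) (c : F) : AnnulusRing F α :=
  ⟨Pi.single k c, by
    intro ρ _
    refine tendsto_nhds_of_eventually_eq ?_
    refine (Set.finite_singleton k).subset fun j hj => ?_
    by_contra h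
    exact hj (by simp [Pi.single_eq_of_ne h])⟩

theorem coeff_monomial (k : ℤ) (c : F) (n : ℤ) :
    (monomial k c : AnnulusRing F α).coeff n = if n = k then c else 0 :=
  Pi.single_apply k c n

theorem gaussNorm_monomial (ρ : Set.Ico (α : ℝ) 1) (k : ℤ) (c : F) :
    gaussNorm ρ (monomial k c : AnnulusRing F α) = ‖c‖ * (ρ : ℝ) ^ k := by
  have hρ := radius_pos ρ
  refine le_antisymm (gaussNorm_le fun n => ?_) ?_
  · rw [coeff_monomial]
    split_ifs with h
    · rw [h]
    · rw [norm_zero, zero_mul]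
      positivity
  · have h := le_gaussNorm ρ (monomial k c : AnnulusRing F α) k
    rwa [coeff_monomial, if_pos rfl] at h

theorem monomial_zero_one : (monomial 0 1 : AnnulusRing F α) = 1 := by
  ext n
  rw [coeff_monomial, coeff_one]

variable [IsUltrametricDist F]

theorem coeff_monomial_mul (k : ℤ) (c : F) (f : AnnulusRing F α) (n : ℤ) :
    (monomial k c * f).coeff n = c * f.coeff (n - k) := by
  rw [coeff_mul, tsum_eq_single k]
  · rw [coeff_monomial, if_pos rfl]
  · intro i hi
    rw [coeff_monomial, if_neg hi, zero_mul]

theorem monomial_mul_monomial (k l : ℤ) (c c' : F) :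
    (monomial k c * monomial l c' : AnnulusRing F α) = monomial (k + l) (c * c') := by
  ext n
  rw [coeff_monomial_mul, coeff_monomial, coeff_monomial]
  by_cases h : n = k + l
  · rw [if_pos h, if_pos (by omega)]
  · rw [if_neg h, if_neg (by omega), mul_zero]

end Truncation

/-! ### Completeness and units -/

section Complete

variable {F : Type*} [NormedField F] [IsUltrametricDist F] {α : Set.Ioo (0 : ℝ) 1}

theorem gaussNorm_sub_le_of_forall_succ (ρ : Set.Ico (α : ℝ) 1) {x : ℕ → AnnulusRing F α}
    {ε : ℝ} (hε : 0 ≤ ε) {n₀ : ℕ} (h : ∀ n ≥ n₀, gaussNorm ρ (x (n + 1) - x n) ≤ ε) {n m : ℕ}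
    (hn : n₀ ≤ n) (hnm : n ≤ m) : gaussNorm ρ (x m - x n) ≤ ε := by
  induction m, hnm using Nat.le_induction with
  | base => simpa using hε
  | succ m hm ih =>
    rw [← sub_add_sub_cancel (x (m + 1)) (x m) (x n)]
    exact (gaussNorm_add_le _ _ _).trans (max_le (h m (hn.trans hm)) ih)

variable [CompleteSpace F]

/-- By the ultrametric inequality, consecutive differences tending to zero already give a Cauchy
sequence for each norm. The limit is taken coefficientwise, and the bounds uniform in `k` show that
it still converges on the annulus. -/
theorem exists_tendsto_gaussNorm_sub {x : ℕ → AnnulusRing F α}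
    (h : ∀ ρ, Tendsto (fun n => gaussNorm ρ (x (n + 1) - x n)) atTop (𝓝 0)) :
    ∃ y : AnnulusRing F α, ∀ ρ, Tendsto (fun n => gaussNorm ρ (y - x n)) atTop (𝓝 0) := by
  have hlim : ∀ k : ℤ, ∃ a : F, Tendsto (fun n => (x n).coeff k) atTop (𝓝 a) := by
    intro k
    refine cauchySeq_tendsto_of_complete (NonarchimedeanAddGroup.cauchySeq_of_tendsto_sub_nhds_zero
      (tendsto_zero_iff_norm_tendsto_zero.2 ?_))
    have hα := zpow_pos (radius_pos (inner α)) k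
    have h1 := (h (inner α)).div_const ((inner α : ℝ) ^ k)
    rw [zero_div] at h1
    refine squeeze_zero (fun n => norm_nonneg _) (fun n => ?_) h1
    rw [le_div_iff₀ hα]
    exact le_gaussNorm (inner α) (x (n + 1) - x n) k
  choose a ha using hlim
  have key : ∀ (ρ : Set.Ico (α : ℝ) 1) (ε : ℝ), 0 < ε → ∃ n₀ : ℕ, ∀ n ≥ n₀, ∀ k,
      ‖a k - (x n).coeff k‖ * (ρ : ℝ) ^ k ≤ ε := by
    intro ρ ε hε
    obtain ⟨n₀, hn₀⟩ := eventually_atTop.1 ((h ρ).eventually (gt_mem_nhds hε))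
    refine ⟨n₀, fun n hn k => ?_⟩
    refine le_of_tendsto (((ha k).sub_const _).norm.mul_const _) ?_
    filter_upwards [eventually_ge_atTop n] with m hm
    exact (le_gaussNorm ρ (x m - x n) k).trans
      (gaussNorm_sub_le_of_forall_succ ρ hε.le (fun i hi => (hn₀ i hi).le) hn hm)
  have hconv : ConvergesOnAnnulus (α : ℝ) a := by
    intro ρ hρ
    have hρ0 : 0 < ρ := pos_of_mem hρ
    rw [Metric.tendsto_nhds]
    intro ε hε
    obtain ⟨n, hn⟩ := key ⟨ρ, hρ⟩ (ε / 2) (half_pos hε)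
    have h2 := ((x n).tendsto hρ).eventually (gt_mem_nhds (half_pos hε))
    filter_upwards [h2] with k hk
    rw [Real.dist_0_eq_abs, abs_of_nonneg (by positivity)]
    have h3 : ‖a k‖ ≤ max ‖a k - (x n).coeff k‖ ‖(x n).coeff k‖ := by
      have := IsUltrametricDist.norm_add_le_max (a k - (x n).coeff k) ((x n).coeff k)
      rwa [sub_add_cancel] at this
    have h4 := mul_le_mul_of_nonneg_right h3 (zpow_pos hρ0 k).le
    rw [max_mul_of_nonneg _ _ (zpow_pos hρ0 k).le] at h4
    exact h4.trans_lt ((max_le (hn n le_rfl k) hk.le).trans_lt (half_lt_self hε))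
  refine ⟨⟨a, hconv⟩, fun ρ => ?_⟩
  rw [Metric.tendsto_atTop]
  intro ε hε
  obtain ⟨n₀, hn₀⟩ := key ρ (ε / 2) (half_pos hε)
  refine ⟨n₀, fun n hn => ?_⟩
  rw [Real.dist_0_eq_abs, abs_of_nonneg (gaussNorm_nonneg _ _)]
  exact (gaussNorm_le (hn₀ n hn)).trans_lt (half_lt_self hε)

theorem eq_of_tendsto_gaussNorm_sub {x : ℕ → AnnulusRing F α} {y z : AnnulusRing F α}
    (ρ : Set.Ico (α : ℝ) 1) (hy : Tendsto (fun n => gaussNorm ρ (y - x n)) atTop (𝓝 0))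
    (hz : Tendsto (fun n => gaussNorm ρ (z - x n)) atTop (𝓝 0)) : y = z := by
  rw [← sub_eq_zero]
  refine eq_zero_of_gaussNorm_lt ρ fun ε hε => ?_
  obtain ⟨n, h1, h2⟩ := ((hy.eventually (gt_mem_nhds hε)).and
    (hz.eventually (gt_mem_nhds hε))).exists
  exact gaussNorm_sub_lt h1 (by rwa [gaussNorm_sub_comm])

theorem tendsto_gaussNorm_mul_sub {x : ℕ → AnnulusRing F α} {y : AnnulusRing F α}
    {ρ : Set.Ico (α : ℝ) 1} (hy : Tendsto (fun n => gaussNorm ρ (y - x n)) atTop (𝓝 0))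
    (f : AnnulusRing F α) : Tendsto (fun n => gaussNorm ρ (f * y - f * x n)) atTop (𝓝 0) := by
  simp_rw [← mul_sub, gaussNorm_mul]
  simpa using hy.const_mul (gaussNorm ρ f)

/-- The geometric series converges for each radius separately; no bound below `1` uniform in `ρ` is
needed. -/
theorem isUnit_one_sub {f : AnnulusRing F α} (hf : ∀ ρ, gaussNorm ρ f < 1) :
    IsUnit (1 - f) := by
  have hpow : ∀ ρ, Tendsto (fun n => gaussNorm ρ (f ^ n)) atTop (𝓝 0) := by
    intro ρ
    simp_rw [gaussNorm_pow]
    exact tendsto_pow_atTop_nhds_zero_of_lt_one (gaussNorm_nonneg _ _) (hf ρ)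
  obtain ⟨y, hy⟩ := exists_tendsto_gaussNorm_sub (x := fun n => ∑ i ∈ Finset.range n, f ^ i)
    (fun ρ => by simpa [Finset.sum_range_succ] using hpow ρ)
  refine IsUnit.of_mul_eq_one y (eq_of_tendsto_gaussNorm_sub (inner α)
    (tendsto_gaussNorm_mul_sub (hy _) (1 - f)) ?_)
  simpa [mul_neg_geom_sum] using hpow (inner α)

theorem isUnit_monomial (k : ℤ) {c : F} (hc : c ≠ 0) :
    IsUnit (monomial k c : AnnulusRing F α) :=
  IsUnit.of_mul_eq_one (monomial (-k) c⁻¹) (by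
    rw [monomial_mul_monomial, add_neg_cancel, mul_inv_cancel₀ hc, monomial_zero_one])

end Complete

/-! ### Division with remainder on a closed annulus -/

variable {F : Type*} [NormedField F] {α : Set.Ioo (0 : ℝ) 1}

theorem gaussNorm_lt {ρ : Set.Ico (α : ℝ) 1} {f : AnnulusRing F α} {c : ℝ} (hc : 0 < c)
    (h : ∀ k, ‖f.coeff k‖ * (ρ : ℝ) ^ k < c) : gaussNorm ρ f < c := by
  rcases eq_or_ne f 0 with rfl | hf
  · simpa using hc
  · obtain ⟨i, hi⟩ := exists_isDominant 1 ρ hf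
    rw [hi.gaussNorm_eq]
    exact h i

theorem zpow_eq_zpow_mul_div_zpow (ρ r : Set.Ico (α : ℝ) 1) (k : ℤ) :
    (r : ℝ) ^ k = (ρ : ℝ) ^ k * ((r : ℝ) / ρ) ^ k := by
  rw [← mul_zpow, mul_div_cancel₀ _ (radius_pos ρ).ne']

theorem IsDominant.lt_of_radius_le {ρ r : Set.Ico (α : ℝ) 1} (h : ρ ≤ r) {f : AnnulusRing F α}
    {i k : ℤ} (hi : IsDominant 1 r f i) (hk : i < k) :
    ‖f.coeff k‖ * (ρ : ℝ) ^ k < gaussNorm ρ f := by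
  refine lt_of_lt_of_le ?_ (le_gaussNorm ρ f i)
  have hρ := radius_pos ρ
  have hr := radius_pos r
  have hi0 := norm_pos_iff.2 hi.1
  have h3 : ((ρ : ℝ) / r) ^ k ≤ ((ρ : ℝ) / r) ^ i :=
    zpow_le_zpow_right_of_le_one₀ (by positivity) ((div_le_one hr).2 h) hk.le
  rw [zpow_eq_zpow_mul_div_zpow r ρ, zpow_eq_zpow_mul_div_zpow r ρ, ← mul_assoc, ← mul_assoc]
  exact mul_lt_mul (hi.2.2 k (by omega)) h3 (by positivity) (by positivity)

theorem IsDominant.lt_of_le_radius {ρ r : Set.Ico (α : ℝ) 1} (h : ρ ≤ r) {f : AnnulusRing F α}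
    {i k : ℤ} (hi : IsDominant (-1) ρ f i) (hk : k < i) :
    ‖f.coeff k‖ * (r : ℝ) ^ k < gaussNorm r f := by
  refine lt_of_lt_of_le ?_ (le_gaussNorm r f i)
  have hρ := radius_pos ρ
  have hr := radius_pos r
  have hi0 := norm_pos_iff.2 hi.1
  have h3 : ((r : ℝ) / ρ) ^ k ≤ ((r : ℝ) / ρ) ^ i :=
    zpow_le_zpow_right₀ ((one_le_div hρ).2 h) hk.le
  rw [zpow_eq_zpow_mul_div_zpow ρ r, zpow_eq_zpow_mul_div_zpow ρ r, ← mul_assoc, ← mul_assoc]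
  exact mul_lt_mul (hi.2.2 k (by omega)) h3 (by positivity) (by positivity)

section Division

variable {r : Set.Ico (α : ℝ) 1} {f : AnnulusRing F α} {μ ν : ℤ}

/-- The indices outside `[μ, ν]` are strictly non-dominant at both end radii, so `f` is a Laurent
polynomial up to a relative error less than `1`. -/
theorem gaussNorm_sub_trunc_Icc_lt (hμ : IsDominant (-1) (inner α) f μ)
    (hν : IsDominant 1 r f ν) :
    gaussNorm (inner α) (f - trunc (Set.Icc μ ν) f) < gaussNorm (inner α) f ∧
      gaussNorm r (f - trunc (Set.Icc μ ν) f) < gaussNorm r f := by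
  have hf : f ≠ 0 := by
    rintro rfl
    exact hμ.1 rfl
  constructor <;>
  · refine gaussNorm_lt (gaussNorm_pos hf _) fun k => ?_
    by_cases hk : k ∈ Set.Icc μ ν
    · rw [coeff_sub, coeff_trunc_of_mem f hk, sub_self, norm_zero, zero_mul]
      exact gaussNorm_pos hf _
    · rw [coeff_sub, coeff_trunc_of_notMem f hk, sub_zero]
      rw [Set.mem_Icc, not_and_or, not_le, not_le] at hk
      rcases hk with hk | hk
      · exact hμ.lt_of_le_radius (inner_le _) hk
      · exact hν.lt_of_radius_le (by first | exact inner_le _ | exact le_rfl) hk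

variable [IsUltrametricDist F] [CompleteSpace F]

/-- Long division from the top. Dominance of `ν` at `r` bounds the quotient there; its exponents are
nonnegative, so it is no larger at the inner radius. -/
theorem exists_div_of_support_upper (hμν : μ ≤ ν) (hν : IsDominant 1 r f ν) {t : ℝ} (ht : 0 ≤ t)
    (m : ℕ) (g : AnnulusRing F α) (hg : gaussNorm r g ≤ t * gaussNorm r f)
    (hs : ∀ k, k ∉ Set.Ico μ (ν + m) → g.coeff k = 0) :
    ∃ q : AnnulusRing F α, gaussNorm (inner α) q ≤ t ∧ gaussNorm r q ≤ t ∧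
      ∀ k, k ∉ Set.Ico μ ν → (g - q * trunc (Set.Icc μ ν) f).coeff k = 0 := by
  induction m generalizing g with
  | zero => exact ⟨0, by simpa using ht, by simpa using ht, by simpa using hs⟩
  | succ m ih =>
    have hr := radius_pos r
    have hν0 := norm_pos_iff.2 hν.1
    -- The interval is half-open, so the top index to cancel is `ν + m`, and the quotient term has
    -- degree `m`.
    set c : F := g.coeff (ν + m) / f.coeff ν with hc
    have hqr : gaussNorm r (monomial (m : ℤ) c : AnnulusRing F α) ≤ t := by
      rw [gaussNorm_monomial, hc, norm_div, div_mul_eq_mul_div, div_le_iff₀ hν0]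
      refine le_of_mul_le_mul_right ?_ (zpow_pos hr ν)
      have h1 := (le_gaussNorm r g (ν + m)).trans hg
      rwa [hν.gaussNorm_eq, zpow_add₀ hr.ne', mul_comm ((r : ℝ) ^ ν), ← mul_assoc,
        ← mul_assoc] at h1
    have hqi : gaussNorm (inner α) (monomial (m : ℤ) c : AnnulusRing F α) ≤ t := by
      refine le_trans ?_ hqr
      rw [gaussNorm_monomial, gaussNorm_monomial]
      exact mul_le_mul_of_nonneg_left
        (zpow_le_zpow_left₀ (by positivity) (radius_pos _).le (inner_le r)) (norm_nonneg _)
    obtain ⟨q, h1, h2, h3⟩ := ih (g - monomial (m : ℤ) c * trunc (Set.Icc μ ν) f) (by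
      refine (gaussNorm_sub_le _ _ _).trans (max_le hg ?_)
      rw [gaussNorm_mul]
      exact mul_le_mul hqr (gaussNorm_trunc_le _ _ _) (gaussNorm_nonneg _ _) ht) (by
      intro k hk
      rw [coeff_sub, coeff_monomial_mul]
      rw [Set.mem_Ico, not_and_or, not_le, not_lt] at hk
      rcases eq_or_ne k (ν + m) with rfl | hne
      · rw [add_sub_cancel_right, coeff_trunc_of_mem (S := Set.Icc μ ν) f ⟨hμν, le_rfl⟩, hc,
          div_mul_cancel₀ _ hν.1, sub_self]
      · rw [hs k (by rw [Set.mem_Ico]; omega), coeff_trunc_of_notMem f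
          (by rw [Set.mem_Icc]; omega), mul_zero, sub_zero])
    refine ⟨monomial (m : ℤ) c + q, (gaussNorm_add_le _ _ _).trans (max_le hqi h1),
      (gaussNorm_add_le _ _ _).trans (max_le hqr h2), fun k hk => ?_⟩
    rw [add_mul, ← sub_sub]
    exact h3 k hk

/-- Mirror image: division from the bottom by negative powers of `T`, bounded at the inner radius
and hence at `r`. -/
theorem exists_div_of_support_lower (hμν : μ ≤ ν) (hμ : IsDominant (-1) (inner α) f μ) {t : ℝ}
    (ht : 0 ≤ t) (m : ℕ) (g : AnnulusRing F α)
    (hg : gaussNorm (inner α) g ≤ t * gaussNorm (inner α) f)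
    (hs : ∀ k, k ∉ Set.Ico (μ - m) ν → g.coeff k = 0) :
    ∃ q : AnnulusRing F α, gaussNorm (inner α) q ≤ t ∧ gaussNorm r q ≤ t ∧
      ∀ k, k ∉ Set.Ico μ ν → (g - q * trunc (Set.Icc μ ν) f).coeff k = 0 := by
  induction m generalizing g with
  | zero => exact ⟨0, by simpa using ht, by simpa using ht, by simpa using hs⟩
  | succ m ih =>
    have hr := radius_pos (inner α)
    have hμ0 := norm_pos_iff.2 hμ.1
    -- The lower end of the interval is included, so the bottom index is `μ - (m + 1)`, one step
    -- further than in the upper case.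
    set l : ℤ := -((m : ℤ) + 1) with hl
    set c : F := g.coeff (μ + l) / f.coeff μ with hc
    have hqi : gaussNorm (inner α) (monomial l c : AnnulusRing F α) ≤ t := by
      rw [gaussNorm_monomial, hc, norm_div, div_mul_eq_mul_div, div_le_iff₀ hμ0]
      refine le_of_mul_le_mul_right ?_ (zpow_pos hr μ)
      have h1 := (le_gaussNorm _ g (μ + l)).trans hg
      rwa [hμ.gaussNorm_eq, zpow_add₀ hr.ne', mul_comm (((inner α : ℝ)) ^ μ), ← mul_assoc,
        ← mul_assoc] at h1
    have hqr : gaussNorm r (monomial l c : AnnulusRing F α) ≤ t := by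
      refine le_trans ?_ hqi
      rw [gaussNorm_monomial, gaussNorm_monomial]
      refine mul_le_mul_of_nonneg_left ?_ (norm_nonneg _)
      rw [hl, zpow_neg, zpow_neg]
      exact inv_anti₀ (zpow_pos hr _)
        (zpow_le_zpow_left₀ (by positivity) (radius_pos _).le (inner_le r))
    obtain ⟨q, h1, h2, h3⟩ := ih (g - monomial l c * trunc (Set.Icc μ ν) f) (by
      refine (gaussNorm_sub_le _ _ _).trans (max_le hg ?_)
      rw [gaussNorm_mul]
      exact mul_le_mul hqi (gaussNorm_trunc_le _ _ _) (gaussNorm_nonneg _ _) ht) (by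
      intro k hk
      rw [coeff_sub, coeff_monomial_mul]
      rw [Set.mem_Ico, not_and_or, not_le, not_lt] at hk
      rcases eq_or_ne k (μ + l) with rfl | hne
      · rw [add_sub_cancel_right, coeff_trunc_of_mem (S := Set.Icc μ ν) f ⟨le_rfl, hμν⟩, hc,
          div_mul_cancel₀ _ hμ.1, sub_self]
      · rw [hs k (by rw [Set.mem_Ico]; push_cast; omega), coeff_trunc_of_notMem f
          (by rw [Set.mem_Icc]; omega), mul_zero, sub_zero])
    refine ⟨monomial l c + q, (gaussNorm_add_le _ _ _).trans (max_le hqi h1),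
      (gaussNorm_add_le _ _ _).trans (max_le hqr h2), fun k hk => ?_⟩
    rw [add_mul, ← sub_sub]
    exact h3 k hk

theorem exists_div_of_finite_support (hμν : μ ≤ ν) (hμ : IsDominant (-1) (inner α) f μ)
    (hν : IsDominant 1 r f ν) {t : ℝ} (ht : 0 ≤ t) (m : ℕ) (g : AnnulusRing F α)
    (hgi : gaussNorm (inner α) g ≤ t * gaussNorm (inner α) f)
    (hgr : gaussNorm r g ≤ t * gaussNorm r f)
    (hs : ∀ k, k ∉ Set.Ico (μ - m) (ν + m) → g.coeff k = 0) :
    ∃ q : AnnulusRing F α, gaussNorm (inner α) q ≤ t ∧ gaussNorm r q ≤ t ∧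
      ∀ k, k ∉ Set.Ico μ ν → (g - q * trunc (Set.Icc μ ν) f).coeff k = 0 := by
  obtain ⟨q₁, h1, h2, h3⟩ := exists_div_of_support_upper hμν hν ht m (trunc (Set.Ici μ) g)
    ((gaussNorm_trunc_le _ _ _).trans hgr) (by
      intro k hk
      by_cases h : k ∈ Set.Ici μ
      · rw [coeff_trunc_of_mem g h]
        simp only [Set.mem_Ici, Set.mem_Ico] at *
        exact hs k (by omega)
      · exact coeff_trunc_of_notMem g h)
  obtain ⟨q₂, h4, h5, h6⟩ := exists_div_of_support_lower (r := r) hμν hμ ht m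
    (trunc (Set.Iio μ) g) ((gaussNorm_trunc_le _ _ _).trans hgi) (by
      intro k hk
      by_cases h : k ∈ Set.Iio μ
      · rw [coeff_trunc_of_mem g h]
        simp only [Set.mem_Iio, Set.mem_Ico] at *
        exact hs k (by omega)
      · exact coeff_trunc_of_notMem g h)
  refine ⟨q₁ + q₂, (gaussNorm_add_le _ _ _).trans (max_le h1 h4),
    (gaussNorm_add_le _ _ _).trans (max_le h2 h5), fun k hk => ?_⟩
  have e : g = trunc (Set.Ici μ) g + trunc (Set.Iio μ) g := by
    ext k
    rw [coeff_add]
    by_cases h : k < μ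
    · rw [coeff_trunc_of_notMem g (by simpa using h), coeff_trunc_of_mem g (Set.mem_Iio.2 h),
        zero_add]
    · rw [coeff_trunc_of_mem g (by simpa using h), coeff_trunc_of_notMem g (by simpa using h),
        add_zero]
  have e' : g - (q₁ + q₂) * trunc (Set.Icc μ ν) f =
      (trunc (Set.Ici μ) g - q₁ * trunc (Set.Icc μ ν) f) +
        (trunc (Set.Iio μ) g - q₂ * trunc (Set.Icc μ ν) f) := by
    nth_rewrite 1 [e]
    ring
  rw [e', coeff_add, h3 k hk, h6 k hk, add_zero]

/-- Approximate division by `f`: the remainder is a Laurent polynomial whose width is smaller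
than that of `f`. -/
theorem exists_approx_div (hμ : IsDominant (-1) (inner α) f μ) (hν : IsDominant 1 r f ν)
    (g : AnnulusRing F α) {ε : ℝ} (hε : 0 < ε) :
    ∃ q s : AnnulusRing F α, (∀ k, k ∉ Set.Ico μ ν → s.coeff k = 0) ∧
      gaussNorm (inner α) (g - f * q - s) < ε ∧ gaussNorm r (g - f * q - s) < ε := by
  have hμν : μ ≤ ν := IsDominant.first_le_last (inner_le r) hμ hν
  have hf : f ≠ 0 := by
    rintro rfl
    exact hμ.1 rfl
  set P := trunc (Set.Icc μ ν) f with hP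
  set A := gaussNorm (inner α) f with hA
  set B := gaussNorm r f with hB
  have hA0 : 0 < A := gaussNorm_pos hf _
  have hB0 : 0 < B := gaussNorm_pos hf _
  obtain ⟨hPA, hPB⟩ := gaussNorm_sub_trunc_Icc_lt hμ hν
  rw [← hP] at hPA hPB
  -- A common contraction ratio at the two radii; the `1 / 2` only keeps it positive.
  obtain ⟨c, hc0, hc1, hcA, hcB⟩ : ∃ c : ℝ, 0 < c ∧ c < 1 ∧
      gaussNorm (inner α) (f - P) ≤ c * A ∧ gaussNorm r (f - P) ≤ c * B := by
    refine ⟨max (1 / 2) (max (gaussNorm (inner α) (f - P) / A) (gaussNorm r (f - P) / B)),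
      by positivity, max_lt (by norm_num) (max_lt ?_ ?_), ?_, ?_⟩
    · rwa [div_lt_one hA0]
    · rwa [div_lt_one hB0]
    · rw [← div_le_iff₀ hA0]
      exact le_max_of_le_right (le_max_left _ _)
    · rw [← div_le_iff₀ hB0]
      exact le_max_of_le_right (le_max_right _ _)
  -- Dividing a truncation of `g` by the polynomial `P` leaves two errors: the tail of `g`, and `q *
  -- (f - P)`. Both gain the factor `c`, so iteration makes them arbitrarily small.
  have step : ∀ (t : ℝ) (g : AnnulusRing F α), 0 < t → gaussNorm (inner α) g ≤ t * A →
      gaussNorm r g ≤ t * B → ∃ q s : AnnulusRing F α, (∀ k, k ∉ Set.Ico μ ν → s.coeff k = 0) ∧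
        gaussNorm (inner α) (g - f * q - s) ≤ c * t * A ∧
        gaussNorm r (g - f * q - s) ≤ c * t * B := by
    intro t g ht hgA hgB
    obtain ⟨m₁, hm₁⟩ := exists_forall_gaussNorm_sub_trunc_le (inner α) g
      (ε := c * t * A) (by positivity)
    obtain ⟨m₂, hm₂⟩ := exists_forall_gaussNorm_sub_trunc_le r g (ε := c * t * B) (by positivity)
    set m : ℕ := m₁ + m₂ + μ.natAbs + ν.natAbs + 1 with hm
    set S : Set ℤ := Set.Ico (μ - m) (ν + m) with hS
    have hS1 : gaussNorm (inner α) (g - trunc S g) ≤ c * t * A := hm₁ S (by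
      intro k hk
      rw [Int.abs_eq_natAbs] at hk
      rw [hS, Set.mem_Ico]
      omega)
    have hS2 : gaussNorm r (g - trunc S g) ≤ c * t * B := hm₂ S (by
      intro k hk
      rw [Int.abs_eq_natAbs] at hk
      rw [hS, Set.mem_Ico]
      omega)
    obtain ⟨q, h1, h2, h3⟩ := exists_div_of_finite_support hμν hμ hν ht.le m (trunc S g)
      ((gaussNorm_trunc_le _ _ _).trans hgA) ((gaussNorm_trunc_le _ _ _).trans hgB)
      (fun k hk => coeff_trunc_of_notMem g hk)
    have e : g - f * q - (trunc S g - q * P) = (g - trunc S g) - q * (f - P) := by ring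
    refine ⟨q, trunc S g - q * P, h3, ?_, ?_⟩
    · rw [e]
      refine (gaussNorm_sub_le _ _ _).trans (max_le hS1 ?_)
      rw [gaussNorm_mul, mul_comm c t, mul_assoc]
      exact mul_le_mul h1 hcA (gaussNorm_nonneg _ _) ht.le
    · rw [e]
      refine (gaussNorm_sub_le _ _ _).trans (max_le hS2 ?_)
      rw [gaussNorm_mul, mul_comm c t, mul_assoc]
      exact mul_le_mul h2 hcB (gaussNorm_nonneg _ _) ht.le
  obtain ⟨t, ht, htA, htB⟩ : ∃ t : ℝ, 0 < t ∧ gaussNorm (inner α) g ≤ t * A ∧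
      gaussNorm r g ≤ t * B := by
    refine ⟨max 1 (max (gaussNorm (inner α) g / A) (gaussNorm r g / B)), by positivity, ?_, ?_⟩
    · rw [← div_le_iff₀ hA0]
      exact le_max_of_le_right (le_max_left _ _)
    · rw [← div_le_iff₀ hB0]
      exact le_max_of_le_right (le_max_right _ _)
  have iter : ∀ n : ℕ, ∃ q s : AnnulusRing F α, (∀ k, k ∉ Set.Ico μ ν → s.coeff k = 0) ∧
      gaussNorm (inner α) (g - f * q - s) ≤ c ^ n * t * A ∧
      gaussNorm r (g - f * q - s) ≤ c ^ n * t * B := by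
    intro n
    induction n with
    | zero => exact ⟨0, 0, by simp, by simpa using htA, by simpa using htB⟩
    | succ n ih =>
      obtain ⟨q, s, hs, h1, h2⟩ := ih
      obtain ⟨q', s', hs', h1', h2'⟩ := step (c ^ n * t) _ (by positivity) h1 h2
      have e : g - f * (q + q') - (s + s') = g - f * q - s - f * q' - s' := by ring
      refine ⟨q + q', s + s', fun k hk => by rw [coeff_add, hs k hk, hs' k hk, add_zero], ?_, ?_⟩
      · rw [e, pow_succ', mul_assoc c]
        exact h1'
      · rw [e, pow_succ', mul_assoc c]
        exact h2'
  have hlim : ∀ D : ℝ, Tendsto (fun n : ℕ => c ^ n * t * D) atTop (𝓝 0) := by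
    intro D
    have := (tendsto_pow_atTop_nhds_zero_of_lt_one hc0.le hc1).mul_const (t * D)
    rw [zero_mul] at this
    exact this.congr fun n => (mul_assoc _ _ _).symm
  obtain ⟨n, hn1, hn2⟩ := (((hlim A).eventually (gt_mem_nhds hε)).and
    ((hlim B).eventually (gt_mem_nhds hε))).exists
  obtain ⟨q, s, hs, h1, h2⟩ := iter n
  exact ⟨q, s, hs, h1.trans_lt hn1, h2.trans_lt hn2⟩

end Division

/-! ### Ideals up to closure on a closed annulus -/

section Approx

variable [IsUltrametricDist F]

/-- `g` is a limit of multiples of `f` on the closed annulus `α ≤ |T| ≤ r`. -/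
def ApproxDvd (r : Set.Ico (α : ℝ) 1) (f g : AnnulusRing F α) : Prop :=
  ∀ ε > 0, ∃ q : AnnulusRing F α, ∀ ρ ≤ r, gaussNorm ρ (g - f * q) < ε

omit [IsUltrametricDist F] in
theorem forall_gaussNorm_lt {r : Set.Ico (α : ℝ) 1} {f : AnnulusRing F α} {ε : ℝ}
    (hi : gaussNorm (inner α) f < ε) (hr : gaussNorm r f < ε) : ∀ ρ ≤ r, gaussNorm ρ f < ε :=
  fun _ hρ => (gaussNorm_le_max hρ f).trans_lt (max_lt hi hr)

variable [CompleteSpace F]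

/-- An ideal is, up to closure on the annulus `α ≤ |T| ≤ r`, generated by one of its elements. -/
theorem exists_mem_forall_approxDvd {I : Ideal (AnnulusRing F α)} (hI : I ≠ ⊥)
    (r : Set.Ico (α : ℝ) 1) : ∃ f ∈ I, f ≠ 0 ∧ ∀ g ∈ I, ApproxDvd r f g := by
  classical
  -- Choose an element of least width between its extremal dominant indices.
  have hex : ∃ n : ℕ, ∃ f ∈ I, ∃ μ ν : ℤ, IsDominant (-1) (inner α) f μ ∧ IsDominant 1 r f ν ∧
      (ν - μ).toNat = n := by
    obtain ⟨f, hf, hf0⟩ := Submodule.exists_mem_ne_zero_of_ne_bot hI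
    obtain ⟨μ, hμ⟩ := exists_isDominant (-1) (inner α) hf0
    obtain ⟨ν, hν⟩ := exists_isDominant 1 r hf0
    exact ⟨_, f, hf, μ, ν, hμ, hν, rfl⟩
  obtain ⟨f, hf, μ, ν, hμ, hν, hn⟩ := Nat.find_spec hex
  have hf0 : f ≠ 0 := by
    rintro rfl
    exact hμ.1 rfl
  refine ⟨f, hf, hf0, fun g hg ε hε => ?_⟩
  have hα := radius_pos (inner α)
  have hr := radius_pos r
  have hle : (inner α : ℝ) ≤ r := inner_le r
  -- For series supported in `[μ, ν)`, the norms at the two end radii bound each other up to the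
  -- factor `C`.
  set C : ℝ := max 1 (max (((r : ℝ) / inner α) ^ ν) (((inner α : ℝ) / r) ^ μ)) with hC
  have hC0 : 0 < C := by positivity
  obtain ⟨q, s, hs, h1, h2⟩ := exists_approx_div hμ hν g (div_pos hε hC0)
  have hεC : ε / C ≤ ε := div_le_self hε.le (le_max_left _ _)
  have hsr : gaussNorm r s ≤ C * gaussNorm (inner α) s := by
    refine gaussNorm_le fun k => ?_
    by_cases hk : k ∈ Set.Ico μ ν
    · rw [zpow_eq_zpow_mul_div_zpow (inner α) r, ← mul_assoc, mul_comm C]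
      refine mul_le_mul (le_gaussNorm _ _ _) ?_ (by positivity) (gaussNorm_nonneg _ _)
      exact le_max_of_le_right (le_max_of_le_left
        (zpow_le_zpow_right₀ ((one_le_div hα).2 hle) hk.2.le))
    · rw [hs k hk, norm_zero, zero_mul]
      exact mul_nonneg hC0.le (gaussNorm_nonneg _ _)
  have hsi : gaussNorm (inner α) s ≤ C * gaussNorm r s := by
    refine gaussNorm_le fun k => ?_
    by_cases hk : k ∈ Set.Ico μ ν
    · rw [zpow_eq_zpow_mul_div_zpow r (inner α), ← mul_assoc, mul_comm C]
      refine mul_le_mul (le_gaussNorm _ _ _) ?_ (by positivity) (gaussNorm_nonneg _ _)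
      exact le_max_of_le_right (le_max_of_le_right
        (zpow_le_zpow_right_of_le_one₀ (by positivity) ((div_le_one hr).2 hle) hk.1))
    · rw [hs k hk, norm_zero, zero_mul]
      exact mul_nonneg hC0.le (gaussNorm_nonneg _ _)
  -- If the remainder `s` were large at both radii, `g - f * q ∈ I` would share its dominant
  -- indices, which lie in `[μ, ν)`: its width would be less than the minimum.
  have hsmall : gaussNorm (inner α) s < ε / C ∨ gaussNorm r s < ε / C := by
    by_contra! hcon
    have hs0 : s ≠ 0 := by
      rintro rfl
      rw [gaussNorm_zero] at hcon
      exact absurd hcon.1 (not_le.2 (div_pos hε hC0))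
    obtain ⟨μ', hμ'⟩ := exists_isDominant (-1) (inner α) hs0
    obtain ⟨ν', hν'⟩ := exists_isDominant 1 r hs0
    have hμν' := IsDominant.first_le_last (inner_le r) hμ' hν'
    have hm1 : μ' ∈ Set.Ico μ ν := by
      by_contra h
      exact hμ'.1 (hs _ h)
    have hm2 : ν' ∈ Set.Ico μ ν := by
      by_contra h
      exact hν'.1 (hs _ h)
    have hmem : g - f * q ∈ I := I.sub_mem hg (I.mul_mem_right q hf)
    refine Nat.find_min hex (m := (ν' - μ').toNat) ?_ ⟨g - f * q, hmem, μ', ν',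
      hμ'.of_sub_lt (h1.trans_le hcon.1), hν'.of_sub_lt (h2.trans_le hcon.2), rfl⟩
    rw [← hn]
    rw [Set.mem_Ico] at hm1 hm2
    omega
  have hεC' : C * (ε / C) = ε := mul_div_cancel₀ _ hC0.ne'
  have hs' : gaussNorm (inner α) s < ε ∧ gaussNorm r s < ε := by
    rcases hsmall with h | h
    · exact ⟨h.trans_le hεC, hsr.trans_lt (hεC' ▸ mul_lt_mul_of_pos_left h hC0)⟩
    · exact ⟨hsi.trans_lt (hεC' ▸ mul_lt_mul_of_pos_left h hC0), h.trans_le hεC⟩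
  refine ⟨q, forall_gaussNorm_lt ?_ ?_⟩
  · rw [← sub_add_cancel (g - f * q) s]
    exact (gaussNorm_add_le _ _ _).trans_lt (max_lt (h1.trans_le hεC) hs'.1)
  · rw [← sub_add_cancel (g - f * q) s]
    exact (gaussNorm_add_le _ _ _).trans_lt (max_lt (h2.trans_le hεC) hs'.2)

end Approx

end AnnulusRing

/-! ### Successive choices and radii tending to 1 -/

theorem exists_seq_of_forall_exists {X : Type*} {P : ℕ → X → Prop} {Q : ℕ → X → X → Prop}
    (h₀ : ∃ x, P 0 x) (h : ∀ n x, P n x → ∃ y, P (n + 1) y ∧ Q n x y) :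
    ∃ x : ℕ → X, ∀ n, P n (x n) ∧ Q n (x n) (x (n + 1)) := by
  choose f hf using h
  obtain ⟨x₀, hx₀⟩ := h₀
  let s : ∀ n, {x // P n x} := fun n =>
    Nat.rec ⟨x₀, hx₀⟩ (fun n x => ⟨f n x.1 x.2, (hf n x.1 x.2).1⟩) n
  exact ⟨fun n => (s n).1, fun n => ⟨(s n).2, (hf n (s n).1 (s n).2).2⟩⟩

namespace AnnulusRing

section Radii

variable {α : Set.Ioo (0 : ℝ) 1}

/-- Take `r n = max α (p ^ (1 / (n + 1)))`. With `p = ‖ϖ‖`, the bound on `r n ^ (n + 1)` lets the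
cut-off degree grow to infinity as the radii tend to `1`. -/
theorem exists_radii (α : Set.Ioo (0 : ℝ) 1) {p : ℝ} (hp0 : 0 < p) (hp1 : p < 1) :
    ∃ r : ℕ → Set.Ico (α : ℝ) 1, Monotone r ∧ (∀ n, p ≤ (r n : ℝ) ^ (n + 1)) ∧
      ∀ ρ, ∀ᶠ n in atTop, ρ ≤ r n := by
  have hlt : ∀ n : ℕ, p ^ ((n : ℝ) + 1)⁻¹ < 1 := fun n =>
    Real.rpow_lt_one hp0.le hp1 (by positivity)
  refine ⟨fun n => ⟨max α (p ^ ((n : ℝ) + 1)⁻¹), le_max_left _ _, max_lt α.2.2 (hlt n)⟩,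
    fun n m hnm => ?_, fun n => ?_, fun ρ => ?_⟩
  · refine Subtype.mk_le_mk.2 (max_le_max le_rfl ?_)
    refine Real.rpow_le_rpow_of_exponent_ge hp0 hp1.le ?_
    have : (n : ℝ) ≤ m := by exact_mod_cast hnm
    gcongr
  · have h1 : (p ^ ((n : ℝ) + 1)⁻¹) ^ (n + 1) = p := by
      have := Real.rpow_inv_natCast_pow hp0.le (Nat.succ_ne_zero n)
      push_cast at this
      exact this
    calc p = (p ^ ((n : ℝ) + 1)⁻¹) ^ (n + 1) := h1.symm
      _ ≤ _ := pow_le_pow_left₀ (by positivity) (le_max_right _ _) _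
  · have h1 : Tendsto (fun n : ℕ => p ^ ((n : ℝ) + 1)⁻¹) atTop (𝓝 (p ^ (0 : ℝ))) := by
      refine Tendsto.rpow tendsto_const_nhds ?_ (Or.inl hp0.ne')
      simpa [one_div] using tendsto_one_div_add_atTop_nhds_zero_nat (𝕜 := ℝ)
    rw [Real.rpow_zero] at h1
    filter_upwards [h1.eventually (lt_mem_nhds ρ.2.2)] with n hn
    exact Subtype.mk_le_mk.2 (hn.le.trans (le_max_right _ _))

end Radii

variable {F : Type*} [NormedField F] [IsUltrametricDist F] {α : Set.Ioo (0 : ℝ) 1}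

/-! ### Approximate divisibility -/

theorem ApproxDvd.mono {r r' : Set.Ico (α : ℝ) 1} {f g : AnnulusRing F α} (h : ApproxDvd r' f g)
    (hr : r ≤ r') : ApproxDvd r f g := fun ε hε =>
  let ⟨q, hq⟩ := h ε hε
  ⟨q, fun ρ hρ => hq ρ (hρ.trans hr)⟩

variable [CompleteSpace F]

theorem ApproxDvd.trans {r : Set.Ico (α : ℝ) 1} {f g h : AnnulusRing F α}
    (h₁ : ApproxDvd r f g) (h₂ : ApproxDvd r g h) : ApproxDvd r f h := by
  intro ε hε
  obtain ⟨p, hp⟩ := h₂ ε hε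
  set D := max 1 (max (gaussNorm (inner α) p) (gaussNorm r p)) with hD
  have hD0 : 0 < D := by positivity
  obtain ⟨q, hq⟩ := h₁ (ε / D) (by positivity)
  refine ⟨q * p, fun ρ hρ => ?_⟩
  have e : h - f * (q * p) = (h - g * p) + (g - f * q) * p := by ring
  rw [e]
  refine (gaussNorm_add_le _ _ _).trans_lt (max_lt (hp ρ hρ) ?_)
  rw [gaussNorm_mul]
  calc gaussNorm ρ (g - f * q) * gaussNorm ρ p ≤ gaussNorm ρ (g - f * q) * D :=
        mul_le_mul_of_nonneg_left ((gaussNorm_le_max hρ p).trans (le_max_right _ _))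
          (gaussNorm_nonneg _ _)
    _ < ε / D * D := mul_lt_mul_of_pos_right (hq ρ hρ) hD0
    _ = ε := div_mul_cancel₀ _ hD0.ne'

theorem gaussNorm_geom_sum_le_one {ρ : Set.Ico (α : ℝ) 1} {x : AnnulusRing F α}
    (hx : gaussNorm ρ x ≤ 1) (n : ℕ) : gaussNorm ρ (∑ i ∈ Finset.range n, x ^ i) ≤ 1 := by
  induction n with
  | zero => simp
  | succ n ih =>
    rw [Finset.sum_range_succ]
    refine (gaussNorm_add_le _ _ _).trans (max_le ih ?_)
    rw [gaussNorm_pow]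
    exact pow_le_one₀ (gaussNorm_nonneg _ _) hx

/-- If `g` is near `f * w` and relatively near `f`, then `|1 - w| < 1`; partial sums of the
geometric series in `1 - w` invert `w` approximately. -/
theorem ApproxDvd.symm_of_sub_lt {r : Set.Ico (α : ℝ) 1} {f g : AnnulusRing F α}
    (h : ApproxDvd r f g) (hf : f ≠ 0)
    (hfg : ∀ ρ ≤ r, gaussNorm ρ (g - f) < gaussNorm ρ f) : ApproxDvd r g f := by
  intro ε hε
  obtain ⟨m, hm, hmf⟩ := exists_forall_le_gaussNorm hf
  obtain ⟨w, hw⟩ := h (min ε m) (by positivity)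
  have hx : ∀ ρ ≤ r, gaussNorm ρ (1 - w) < 1 := by
    intro ρ hρ
    have hf0 := gaussNorm_pos hf ρ
    have h1 : gaussNorm ρ (f * (1 - w)) < gaussNorm ρ f := by
      rw [show f * (1 - w) = f - f * w by ring]
      refine gaussNorm_sub_lt (g := g) ?_ ((hw ρ hρ).trans_le ((min_le_right _ _).trans (hmf ρ)))
      rw [gaussNorm_sub_comm]
      exact hfg ρ hρ
    rw [gaussNorm_mul] at h1
    exact lt_of_mul_lt_mul_left (by rwa [mul_one]) hf0.le
  have hlim : ∀ ρ ≤ r, Tendsto (fun n => gaussNorm ρ (f * (1 - w) ^ n)) atTop (𝓝 0) := by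
    intro ρ hρ
    simp_rw [gaussNorm_mul, gaussNorm_pow]
    simpa using (tendsto_pow_atTop_nhds_zero_of_lt_one (gaussNorm_nonneg ρ (1 - w))
      (hx ρ hρ)).const_mul (gaussNorm ρ f)
  obtain ⟨n, hn1, hn2⟩ := (((hlim _ (inner_le r)).eventually (gt_mem_nhds hε)).and
    ((hlim r le_rfl).eventually (gt_mem_nhds hε))).exists
  refine ⟨∑ i ∈ Finset.range n, (1 - w) ^ i, fun ρ hρ => ?_⟩
  have hgs := mul_neg_geom_sum (1 - w) n
  rw [sub_sub_cancel] at hgs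
  have e : f - g * ∑ i ∈ Finset.range n, (1 - w) ^ i =
      f * (1 - w) ^ n - (g - f * w) * ∑ i ∈ Finset.range n, (1 - w) ^ i := by
    linear_combination (-f) * hgs
  rw [e]
  refine (gaussNorm_sub_le _ _ _).trans_lt (max_lt (forall_gaussNorm_lt hn1 hn2 ρ hρ) ?_)
  rw [gaussNorm_mul]
  exact (mul_le_of_le_one_right (gaussNorm_nonneg _ _)
    (gaussNorm_geom_sum_le_one (hx ρ hρ).le n)).trans_lt ((hw ρ hρ).trans_le (min_le_left _ _))

/-- By multiplicativity of the norms, approximate quotients on growing annuli form a Cauchy sequence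
at each radius, once errors are divided by `|f|_ρ`. -/
theorem dvd_of_forall_approxDvd {f g : AnnulusRing F α} (hf : f ≠ 0)
    (h : ∀ r, ApproxDvd r f g) : f ∣ g := by
  obtain ⟨r, hmono, -, hr⟩ := exists_radii α (p := 1 / 2) (by norm_num) (by norm_num)
  have hpos : ∀ n : ℕ, (0 : ℝ) < 1 / ((n : ℝ) + 1) := fun n => by positivity
  choose y hy using fun n : ℕ => h (r n) (1 / ((n : ℝ) + 1)) (hpos n)
  have hlim := tendsto_one_div_add_atTop_nhds_zero_nat (𝕜 := ℝ)
  obtain ⟨z, hz⟩ := exists_tendsto_gaussNorm_sub (x := y) (fun ρ => by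
    have hf0 := gaussNorm_pos hf ρ
    have h1 := hlim.div_const (gaussNorm ρ f)
    rw [zero_div] at h1
    refine squeeze_zero' (Eventually.of_forall fun n => gaussNorm_nonneg _ _) ?_ h1
    filter_upwards [hr ρ] with n hn
    rw [le_div_iff₀ hf0, mul_comm, ← gaussNorm_mul, mul_sub]
    refine (gaussNorm_sub_lt (g := g) ?_ (hy n ρ hn)).le
    rw [gaussNorm_sub_comm]
    refine (hy (n + 1) ρ (hn.trans (hmono n.le_succ))).trans_le ?_
    push_cast
    gcongr
    linarith)
  refine ⟨z, eq_of_tendsto_gaussNorm_sub (x := fun n => f * y n) (inner α) ?_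
    (tendsto_gaussNorm_mul_sub (hz _) f)⟩
  exact squeeze_zero (fun n => gaussNorm_nonneg _ _)
    (fun n => (hy n _ (inner_le _)).le) hlim

/-- Two elements that approximately divide each other on a closed annulus differ there by a
factor close to a function without zeros. -/
theorem exists_monomial_mul_of_approxDvd {r : Set.Ico (α : ℝ) 1} {f g : AnnulusRing F α}
    (hf : f ≠ 0) (hg : g ≠ 0) (hfg : ApproxDvd r f g) (hgf : ApproxDvd r g f) {ε : ℝ}
    (hε : 0 < ε) : ∃ (k : ℤ) (c : F) (h : AnnulusRing F α), c ≠ 0 ∧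
      (∀ ρ ≤ r, gaussNorm ρ h < 1) ∧
      ∀ ρ ≤ r, gaussNorm ρ (g - f * (monomial k c * (1 + h))) < ε := by
  obtain ⟨m₁, hm₁, hmf⟩ := exists_forall_le_gaussNorm hf
  obtain ⟨m₂, hm₂, hmg⟩ := exists_forall_le_gaussNorm hg
  obtain ⟨q, hq⟩ := hfg (min ε m₂) (by positivity)
  obtain ⟨p, hp⟩ := hgf m₁ hm₁
  have hgp : ∀ ρ ≤ r, gaussNorm ρ g * gaussNorm ρ p = gaussNorm ρ f := by
    intro ρ hρ
    rw [← gaussNorm_mul]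
    refine gaussNorm_eq_of_sub_lt ?_
    rw [gaussNorm_sub_comm]
    exact (hp ρ hρ).trans_le (hmf ρ)
  have hp0 : p ≠ 0 := by
    rintro rfl
    have h1 := hgp r le_rfl
    rw [gaussNorm_zero, mul_zero] at h1
    exact (gaussNorm_pos hf r).ne h1
  have hqp : ∀ ρ ≤ r, gaussNorm ρ (q * p - 1) < 1 := by
    intro ρ hρ
    have hf0 := gaussNorm_pos hf ρ
    have h1 : gaussNorm ρ (f * (1 - q * p)) < gaussNorm ρ f := by
      rw [show f * (1 - q * p) = (f - g * p) + (g - f * q) * p by ring]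
      refine (gaussNorm_add_le _ _ _).trans_lt (max_lt ((hp ρ hρ).trans_le (hmf ρ)) ?_)
      rw [gaussNorm_mul, ← hgp ρ hρ]
      exact mul_lt_mul_of_pos_right ((hq ρ hρ).trans_le ((min_le_right _ _).trans (hmg ρ)))
        (gaussNorm_pos hp0 ρ)
    rw [gaussNorm_mul] at h1
    rw [gaussNorm_sub_comm]
    exact lt_of_mul_lt_mul_left (by rwa [mul_one]) hf0.le
  have hq0 : q ≠ 0 := by
    rintro rfl
    have h1 := hqp r le_rfl
    rw [zero_mul, zero_sub, gaussNorm_neg, gaussNorm_one] at h1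
    exact lt_irrefl _ h1
  obtain ⟨μ, hμ⟩ := exists_isDominant (-1) (inner α) hq0
  obtain ⟨ν, hν⟩ := exists_isDominant 1 r hq0
  obtain ⟨μ', hμ'⟩ := exists_isDominant (-1) (inner α) hp0
  obtain ⟨ν', hν'⟩ := exists_isDominant 1 r hp0
  have hle := IsDominant.first_le_last (inner_le r) hμ hν
  have hle' := IsDominant.first_le_last (inner_le r) hμ' hν'
  -- Since `q * p` is close to `1`, its extremal dominant indices are `0` at both radii. The widths
  -- of `q` and `p` are nonnegative with sum zero, so `q` is a monomial up to a relative error less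
  -- than `1`.
  have e1 : μ + μ' = 0 := (hμ.mul (by norm_num) hμ').unique (by norm_num)
    ((isDominant_one (-1) (inner α)).of_sub_lt (by rw [gaussNorm_one]; exact hqp _ (inner_le r)))
  have e2 : ν + ν' = 0 := (hν.mul (by norm_num) hν').unique (by norm_num)
    ((isDominant_one 1 r).of_sub_lt (by rw [gaussNorm_one]; exact hqp _ le_rfl))
  obtain rfl : ν = μ := by omega
  set c := q.coeff ν with hc
  have hc0 : c ≠ 0 := hμ.1
  have et : trunc (Set.Icc ν ν) q = monomial ν c := by
    ext n
    rw [coeff_monomial]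
    by_cases hn : n = ν
    · rw [if_pos hn, coeff_trunc_of_mem q (by simp [hn]), hn]
    · rw [if_neg hn, coeff_trunc_of_notMem q (by simp [hn])]
  have emm : (monomial ν c * monomial (-ν) c⁻¹ : AnnulusRing F α) = 1 := by
    rw [monomial_mul_monomial, add_neg_cancel, mul_inv_cancel₀ hc0, monomial_zero_one]
  obtain ⟨hi, hr⟩ := gaussNorm_sub_trunc_Icc_lt hμ hν
  rw [et] at hi hr
  have key : ∀ ρ, gaussNorm ρ (q - monomial ν c) < gaussNorm ρ q →
      gaussNorm ρ (monomial (-ν) c⁻¹ * q - 1) < 1 := by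
    intro ρ hρ
    have h1 := gaussNorm_eq_of_sub_lt (f := monomial ν c) (by rwa [gaussNorm_sub_comm])
    rw [← h1, show q - monomial ν c = monomial ν c * (monomial (-ν) c⁻¹ * q - 1) by
      linear_combination (-q) * emm, gaussNorm_mul] at hρ
    exact lt_of_mul_lt_mul_left (by rwa [mul_one]) (gaussNorm_nonneg _ _)
  refine ⟨ν, c, monomial (-ν) c⁻¹ * q - 1, hc0, forall_gaussNorm_lt (key _ hi) (key _ hr),
    fun ρ hρ => ?_⟩
  rw [add_sub_cancel, ← mul_assoc (monomial ν c), emm, one_mul]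
  exact (hq ρ hρ).trans_le (min_le_left _ _)

/-! ### Discreteness of the valuation and closures of ideals -/

section Discrete

variable {ϖ : F}

/-- Over a discretely valued field, a function close to `1` on a closed annulus is the product of
a unit on the whole half-open annulus and of a function that is closer to `1` on smaller annuli. -/
theorem exists_unit_mul_one_add (hϖ1 : ‖ϖ‖ < 1)
    (hϖ : ∀ x : F, x ≠ 0 → ∃ n : ℤ, ‖x‖ = ‖ϖ‖ ^ n) {r : Set.Ico (α : ℝ) 1} {K : ℕ}
    (hK : ‖ϖ‖ ≤ (r : ℝ) ^ K) {h : AnnulusRing F α} (hh : ∀ ρ ≤ r, gaussNorm ρ h < 1) :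
    ∃ (u : (AnnulusRing F α)ˣ) (h' : AnnulusRing F α), 1 + h = u * (1 + h') ∧
      ∀ ρ ≤ r, gaussNorm ρ h' < 1 ∧ gaussNorm ρ h' ≤ ((ρ : ℝ) / r) ^ K := by
  have hr := radius_pos r
  set S : Set ℤ := Set.Iic (K : ℤ) with hS
  -- By discreteness a norm above `1` is at least `‖ϖ‖⁻¹`; then `‖h.coeff j‖ * r ^ j` would reach
  -- `‖ϖ‖⁻¹ * r ^ K ≥ 1`.
  have hcoeff : ∀ j : ℤ, 0 < j → j ≤ K → ‖h.coeff j‖ ≤ 1 := by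
    intro j hj hjK
    by_contra! hcon
    have hne : h.coeff j ≠ 0 := norm_pos_iff.1 (one_pos.trans hcon)
    obtain ⟨n, hn⟩ := hϖ _ hne
    have hϖ0 : 0 < ‖ϖ‖ := by
      rcases (norm_nonneg ϖ).eq_or_lt with h0 | h0
      · rw [← h0] at hn
        rcases eq_or_ne n 0 with rfl | hn0
        · simp [hn] at hcon
        · rw [zero_zpow _ hn0] at hn
          rw [hn] at hcon
          linarith
      · exact h0
    have hneg : n ≤ -1 := by
      by_contra! h1
      have : ‖ϖ‖ ^ n ≤ 1 := zpow_le_one₀ hϖ0 hϖ1.le (by omega)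
      linarith
    have h1 : ‖ϖ‖⁻¹ ≤ ‖h.coeff j‖ := by
      rw [hn, ← zpow_neg_one]
      exact zpow_le_zpow_right_of_le_one₀ hϖ0 hϖ1.le hneg
    have h2 : (r : ℝ) ^ (K : ℤ) ≤ (r : ℝ) ^ j :=
      zpow_le_zpow_right_of_le_one₀ hr (radius_lt_one r).le hjK
    rw [zpow_natCast] at h2
    have h3 := (le_gaussNorm r h j).trans_lt (hh r le_rfl)
    have h4 : ‖ϖ‖⁻¹ * ‖ϖ‖ ≤ ‖h.coeff j‖ * (r : ℝ) ^ j :=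
      mul_le_mul h1 (hK.trans h2) (norm_nonneg _) (norm_nonneg _)
    rw [inv_mul_cancel₀ hϖ0.ne'] at h4
    linarith
  -- Terms of index at most `0` are controlled by the inner radius, those of index in `(0, K]` by
  -- `ρ`. So the low part is small at every radius below `1`, also beyond `r`.
  have hv : ∀ ρ, gaussNorm ρ (-trunc S h) < 1 := by
    intro ρ
    rw [gaussNorm_neg]
    refine lt_of_le_of_lt (gaussNorm_le (c := max (gaussNorm (inner α) h) ρ) fun j => ?_)
      (max_lt (hh _ (inner_le r)) (radius_lt_one ρ))
    have hρ := radius_pos ρ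
    by_cases hj : j ∈ S
    · rw [coeff_trunc_of_mem h hj]
      rcases le_or_gt j 0 with hj0 | hj0
      · refine le_max_of_le_left (le_trans ?_ (le_gaussNorm _ h j))
        refine mul_le_mul_of_nonneg_left ?_ (norm_nonneg _)
        have h1 := radius_pos (inner α)
        rw [← neg_neg j, zpow_neg _ (-j), zpow_neg _ (-j)]
        exact inv_anti₀ (zpow_pos h1 _) (zpow_le_zpow_left₀ (by omega) h1.le (inner_le ρ))
      · refine le_max_of_le_right ?_
        have h1 : (ρ : ℝ) ^ j ≤ (ρ : ℝ) ^ (1 : ℤ) :=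
          zpow_le_zpow_right_of_le_one₀ hρ (radius_lt_one ρ).le (by omega)
        rw [zpow_one] at h1
        calc _ ≤ 1 * (ρ : ℝ) := mul_le_mul (hcoeff j hj0 hj) h1 (by positivity) zero_le_one
          _ = ρ := one_mul _
    · rw [coeff_trunc_of_notMem h hj, norm_zero, zero_mul]
      positivity
  obtain ⟨u, hu⟩ := isUnit_one_sub hv
  rw [sub_neg_eq_add] at hu
  have hun : ∀ ρ, gaussNorm ρ (u : AnnulusRing F α) = 1 := by
    intro ρ
    rw [← gaussNorm_one (F := F) ρ]
    refine gaussNorm_eq_of_sub_lt ?_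
    rw [hu, add_sub_cancel_left, gaussNorm_one, ← gaussNorm_neg]
    exact hv ρ
  have hun' : ∀ ρ, gaussNorm ρ ((u⁻¹ : (AnnulusRing F α)ˣ) : AnnulusRing F α) = 1 := by
    intro ρ
    have h1 := gaussNorm_mul ρ (u : AnnulusRing F α) ((u⁻¹ : (AnnulusRing F α)ˣ) : AnnulusRing F α)
    rwa [Units.mul_inv, gaussNorm_one, hun, one_mul, eq_comm] at h1
  have esplit : h = trunc S h + trunc Sᶜ h := by
    ext k
    rw [coeff_add]
    by_cases hk : k ∈ S
    · rw [coeff_trunc_of_mem h hk, coeff_trunc_of_notMem h (not_not_intro hk), add_zero]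
    · rw [coeff_trunc_of_notMem h hk, coeff_trunc_of_mem h hk, zero_add]
  refine ⟨u, (u⁻¹ : (AnnulusRing F α)ˣ) * trunc Sᶜ h, ?_, fun ρ hρ => ?_⟩
  · rw [mul_add, mul_one, Units.mul_inv_cancel_left, hu, add_assoc, ← esplit]
  · rw [gaussNorm_mul, hun', one_mul]
    refine ⟨(gaussNorm_trunc_le _ _ _).trans_lt (hh ρ hρ), gaussNorm_le fun k => ?_⟩
    have hρ0 := radius_pos ρ
    by_cases hk : k ∈ Sᶜ
    · rw [coeff_trunc_of_mem h hk, zpow_eq_zpow_mul_div_zpow r ρ, ← mul_assoc]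
      have hk' : (K : ℤ) ≤ k := by
        simp only [hS, Set.mem_compl_iff, Set.mem_Iic, not_le] at hk
        exact hk.le
      have h1 : ((ρ : ℝ) / r) ^ k ≤ ((ρ : ℝ) / r) ^ (K : ℤ) :=
        zpow_le_zpow_right_of_le_one₀ (by positivity) ((div_le_one hr).2 hρ) hk'
      rw [zpow_natCast] at h1
      calc _ ≤ 1 * ((ρ : ℝ) / r) ^ K :=
            mul_le_mul ((le_gaussNorm r h k).trans (hh r le_rfl).le) h1 (by positivity) zero_le_one
        _ = _ := one_mul _
    · rw [coeff_trunc_of_notMem h hk, norm_zero, zero_mul]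
      positivity

/-- An approximate generator `g` for `r'` is close to `f * c T^k * u * (1 + h')` on the smaller
annulus. The factor `c T^k * u` is a unit of the whole ring, so it can be divided out of `g` without
leaving `I`; what remains differs from `f` essentially by `f * h'`. -/
theorem exists_next_generator (hϖ1 : ‖ϖ‖ < 1)
    (hϖ : ∀ x : F, x ≠ 0 → ∃ n : ℤ, ‖x‖ = ‖ϖ‖ ^ n) {I : Ideal (AnnulusRing F α)}
    {r r' : Set.Ico (α : ℝ) 1} (hrr' : r ≤ r') {K : ℕ} (hK : ‖ϖ‖ ≤ (r : ℝ) ^ K)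
    {δ : ℝ} (hδ : 0 < δ) {f : AnnulusRing F α} (hfI : f ∈ I) (hf : f ≠ 0)
    (hgen : ∀ g ∈ I, ApproxDvd r f g) :
    ∃ f' ∈ I, f' ≠ 0 ∧ (∀ g ∈ I, ApproxDvd r' f' g) ∧
      ∀ ρ ≤ r, gaussNorm ρ (f' - f) ≤ max δ (((ρ : ℝ) / r) ^ K) * gaussNorm ρ f := by
  have hI : I ≠ ⊥ := (Submodule.ne_bot_iff _).2 ⟨f, hfI, hf⟩
  obtain ⟨g, hgI, hg, hgen'⟩ := exists_mem_forall_approxDvd hI r'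
  obtain ⟨m, hm, hmg⟩ := exists_forall_le_gaussNorm hg
  obtain ⟨k, c, h, hc, hh, happ⟩ := exists_monomial_mul_of_approxDvd hf hg (hgen g hgI)
    ((hgen' f hfI).mono hrr') (ε := min 1 δ * m) (by positivity)
  obtain ⟨u, h', hu, hh'⟩ := exists_unit_mul_one_add hϖ1 hϖ hK hh
  obtain ⟨v, hv⟩ := isUnit_monomial (F := F) (α := α) k hc
  obtain ⟨w, w', hww', hw⟩ : ∃ w w' : AnnulusRing F α, w' * w = 1 ∧
      monomial k c * (1 + h) = w * (1 + h') := by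
    refine ⟨(v * u : (AnnulusRing F α)ˣ), ((v * u)⁻¹ : (AnnulusRing F α)ˣ), Units.inv_mul _, ?_⟩
    rw [hu, ← hv, Units.val_mul, mul_assoc]
  rw [hw] at happ
  have hw0 : w ≠ 0 := right_ne_zero_of_mul (hww' ▸ one_ne_zero)
  have hw'0 : w' ≠ 0 := left_ne_zero_of_mul (hww' ▸ one_ne_zero)
  refine ⟨w' * g, I.mul_mem_left _ hgI, mul_ne_zero hw'0 hg, fun x hx ε hε => ?_,
    fun ρ hρ => ?_⟩
  · obtain ⟨q, hq⟩ := hgen' x hx ε hε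
    refine ⟨w * q, fun ρ hρ => ?_⟩
    rw [mul_mul_mul_comm, hww', one_mul]
    exact hq ρ hρ
  · obtain ⟨h1, h2⟩ := hh' ρ hρ
    have hone : gaussNorm ρ (1 + h') = 1 := by
      rw [← gaussNorm_one (F := F) ρ]
      refine gaussNorm_eq_of_sub_lt ?_
      rwa [add_sub_cancel_left, gaussNorm_one]
    have hlt : gaussNorm ρ (g - f * (w * (1 + h'))) < gaussNorm ρ g := by
      refine (happ ρ hρ).trans_le (le_trans ?_ (hmg ρ))
      exact mul_le_of_le_one_left hm.le (min_le_left _ _)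
    have heq : gaussNorm ρ f * gaussNorm ρ w = gaussNorm ρ g := by
      have h3 := gaussNorm_eq_of_sub_lt (f := f * (w * (1 + h'))) (by rwa [gaussNorm_sub_comm])
      rwa [gaussNorm_mul, gaussNorm_mul, hone, mul_one] at h3
    have e : w' * g - f = w' * (g - f * (w * (1 + h'))) + f * h' := by
      linear_combination (f * (1 + h')) * hww'
    rw [e]
    refine (gaussNorm_add_le _ _ _).trans (max_le ?_ ?_)
    · refine le_trans ?_ (mul_le_mul_of_nonneg_right (le_max_left _ _) (gaussNorm_nonneg _ _))
      refine le_of_mul_le_mul_right ?_ (gaussNorm_pos hw0 ρ)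
      rw [gaussNorm_mul, mul_right_comm, ← gaussNorm_mul, hww', gaussNorm_one, one_mul,
        mul_assoc, heq]
      refine (happ ρ hρ).le.trans ?_
      exact mul_le_mul (min_le_right _ _) (hmg ρ) hm.le hδ.le
    · rw [gaussNorm_mul, mul_comm]
      exact mul_le_mul_of_nonneg_right (h2.trans (le_max_right _ _)) (gaussNorm_nonneg _ _)

/-- The closure of a nonzero ideal is principal. -/
theorem exists_generator_of_closure (hϖ0 : 0 < ‖ϖ‖) (hϖ1 : ‖ϖ‖ < 1)
    (hϖ : ∀ x : F, x ≠ 0 → ∃ n : ℤ, ‖x‖ = ‖ϖ‖ ^ n) {I : Ideal (AnnulusRing F α)} (hI : I ≠ ⊥) :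
    ∃ g : AnnulusRing F α, g ≠ 0 ∧ (∀ f ∈ I, g ∣ f) ∧
      ∀ r : Set.Ico (α : ℝ) 1, ∀ ε > 0, ∃ f ∈ I, ∀ ρ ≤ r, gaussNorm ρ (g - f) < ε := by
  obtain ⟨r, hmono, hrϖ, hr⟩ := exists_radii α hϖ0 hϖ1
  obtain ⟨f, hf⟩ := exists_seq_of_forall_exists
    (P := fun n (f : AnnulusRing F α) => f ∈ I ∧ f ≠ 0 ∧ ∀ g ∈ I, ApproxDvd (r n) f g)
    (Q := fun n f f' => ∀ ρ ≤ r n, gaussNorm ρ (f' - f) ≤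
      max (1 / ((n : ℝ) + 1)) (((ρ : ℝ) / r n) ^ (n + 1)) * gaussNorm ρ f)
    (exists_mem_forall_approxDvd hI (r 0))
    (fun n f ⟨h1, h2, h3⟩ => by
      obtain ⟨f', h4, h5, h6, h7⟩ := exists_next_generator hϖ1 hϖ (hmono n.le_succ) (hrϖ n)
        (δ := 1 / ((n : ℝ) + 1)) (by positivity) h1 h2 h3
      exact ⟨f', ⟨h4, h5, h6⟩, h7⟩)
  -- Here `(ρ / r n) ^ (n + 1) ≤ ρ ^ (n + 1) / ‖ϖ‖`, by the choice of the radii.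
  have hfac : ∀ ρ : Set.Ico (α : ℝ) 1, Tendsto
      (fun n : ℕ => max (1 / ((n : ℝ) + 1)) (((ρ : ℝ) / r n) ^ (n + 1))) atTop (𝓝 0) := by
    intro ρ
    have hρ := radius_pos ρ
    have h1 := ((tendsto_pow_atTop_nhds_zero_of_lt_one hρ.le (radius_lt_one ρ)).comp
      (tendsto_add_atTop_nat 1)).div_const ‖ϖ‖
    rw [zero_div] at h1
    have h2 := (tendsto_one_div_add_atTop_nhds_zero_nat (𝕜 := ℝ)).max h1
    rw [max_self] at h2
    refine squeeze_zero (fun n => by positivity) (fun n => max_le_max le_rfl ?_) h2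
    rw [div_pow]
    exact div_le_div_of_nonneg_left (by positivity) hϖ0 (hrϖ n)
  have hhalf : ∀ ρ : Set.Ico (α : ℝ) 1, ∃ n₀ : ℕ, ∀ n ≥ n₀,
      gaussNorm ρ (f (n + 1) - f n) ≤ 1 / 2 * gaussNorm ρ (f n) := by
    intro ρ
    obtain ⟨n₀, hn₀⟩ := eventually_atTop.1 ((hr ρ).and
      ((hfac ρ).eventually (gt_mem_nhds (show (0 : ℝ) < 1 / 2 by norm_num))))
    exact ⟨n₀, fun n hn => ((hf n).2 ρ (hn₀ n hn).1).trans
      (mul_le_mul_of_nonneg_right (hn₀ n hn).2.le (gaussNorm_nonneg _ _))⟩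
  -- Relative changes below `1` preserve an ultrametric norm. The norms become stationary, which
  -- makes the sequence Cauchy and its limit nonzero.
  have hconst : ∀ ρ : Set.Ico (α : ℝ) 1, ∃ n₀ : ℕ, ∀ n ≥ n₀,
      gaussNorm ρ (f n) = gaussNorm ρ (f n₀) := by
    intro ρ
    obtain ⟨n₀, hn₀⟩ := hhalf ρ
    refine ⟨n₀, fun n hn => ?_⟩
    induction n, hn using Nat.le_induction with
    | base => rfl
    | succ n hn ih =>
      rw [← ih]
      refine gaussNorm_eq_of_sub_lt ((hn₀ n hn).trans_lt ?_)
      have := gaussNorm_pos (hf n).1.2.1 ρ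
      linarith
  obtain ⟨g, hg⟩ := exists_tendsto_gaussNorm_sub (x := f) (fun ρ => by
    obtain ⟨n₀, hn₀⟩ := hconst ρ
    have h1 := (hfac ρ).mul_const (gaussNorm ρ (f n₀))
    rw [zero_mul] at h1
    refine squeeze_zero' (Eventually.of_forall fun n => gaussNorm_nonneg _ _) ?_ h1
    filter_upwards [hr ρ, eventually_ge_atTop n₀] with n hn hn'
    rw [← hn₀ n hn']
    exact (hf n).2 ρ hn)
  have happrox : ∀ r : Set.Ico (α : ℝ) 1, ∀ ε > 0, ∃ f ∈ I, ∀ ρ ≤ r, gaussNorm ρ (g - f) < ε := by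
    intro s ε hε
    obtain ⟨n, h1, h2⟩ := (((hg (inner α)).eventually (gt_mem_nhds hε)).and
      ((hg s).eventually (gt_mem_nhds hε))).exists
    exact ⟨f n, (hf n).1.1, forall_gaussNorm_lt h1 h2⟩
  have hg0 : g ≠ 0 := by
    rintro rfl
    obtain ⟨n₀, hn₀⟩ := hconst (inner α)
    obtain ⟨n, hn, hn'⟩ := (((hg (inner α)).eventually
      (gt_mem_nhds (gaussNorm_pos (hf n₀).1.2.1 (inner α)))).and (eventually_ge_atTop n₀)).exists
    rw [zero_sub, gaussNorm_neg, hn₀ n hn'] at hn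
    exact lt_irrefl _ hn
  refine ⟨g, hg0, fun x hx => dvd_of_forall_approxDvd hg0 fun s => ?_, happrox⟩
  -- For `n` large, `f n` is relatively close to `g` on the annulus of radius `s`. It approximately
  -- divides `g`, hence conversely `g` approximately divides `f n`, and so every element of `I`.
  obtain ⟨n, hsn, hn⟩ : ∃ n, s ≤ r n ∧ ∀ ρ ≤ s, gaussNorm ρ (g - f n) < gaussNorm ρ (f n) := by
    obtain ⟨m, hm, hmg⟩ := exists_forall_le_gaussNorm hg0
    obtain ⟨n, h1, h2, h3⟩ := (((hg (inner α)).eventually (gt_mem_nhds hm)).and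
      (((hg s).eventually (gt_mem_nhds hm)).and (hr s))).exists
    refine ⟨n, h3, fun ρ hρ => ?_⟩
    have h4 := (forall_gaussNorm_lt h1 h2 ρ hρ).trans_le (hmg ρ)
    rwa [gaussNorm_eq_of_sub_lt (f := f n) (g := g) (by rwa [gaussNorm_sub_comm])]
  have hfg : ApproxDvd s (f n) g := by
    intro ε hε
    obtain ⟨y, hy, hgy⟩ := happrox s ε hε
    obtain ⟨q, hq⟩ := (hf n).1.2.2 y hy ε hε
    exact ⟨q, fun ρ hρ => gaussNorm_sub_lt (hgy ρ hρ) (hq ρ (hρ.trans hsn))⟩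
  exact (hfg.symm_of_sub_lt (hf n).1.2.1 hn).trans (((hf n).1.2.2 x hx).mono hsn)

end Discrete

/-! ### Closed submodules of finite free modules -/

variable {F : Type*} [NormedField F] [IsUltrametricDist F] [CompleteSpace F]
  {α : Set.Ioo (0 : ℝ) 1} {ϖ : F}

/-- A submodule of a power of the ring of analytic functions is sequentially closed for the Gauss
norms of the coordinates. -/
def IsSeqClosedSubmodule {ι : Type*} (N : Submodule (AnnulusRing F α) (ι → AnnulusRing F α)) :
    Prop :=
  ∀ (x : ℕ → ι → AnnulusRing F α) (y : ι → AnnulusRing F α), (∀ n, x n ∈ N) →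
    (∀ ρ i, Tendsto (fun n => gaussNorm ρ (y i - x n i)) atTop (𝓝 0)) → y ∈ N

/-- The point is that `C` does not depend on `ε`: one `x` is fixed for the annulus and only its
multiplier `w` varies, with `|w|_ρ` forced to be `|g|_ρ / |p x|_ρ`. -/
theorem exists_bounded_approx {ι : Type*} [Finite ι] {N : Submodule (AnnulusRing F α) (ι → AnnulusRing F α)}
    {p : (ι → AnnulusRing F α) →ₗ[AnnulusRing F α] AnnulusRing F α}
    {g : AnnulusRing F α} (hg : g ≠ 0) (hdvd : ∀ f ∈ N.map p, g ∣ f)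
    (hcl : ∀ r : Set.Ico (α : ℝ) 1, ∀ ε > 0, ∃ f ∈ N.map p, ∀ ρ ≤ r, gaussNorm ρ (g - f) < ε)
    (hI : N.map p ≠ ⊥) (r : Set.Ico (α : ℝ) 1) :
    ∃ C : ℝ, 0 < C ∧ ∀ ε > 0, ∃ x ∈ N, ∃ s : AnnulusRing F α, p x = g * (1 - s) ∧
      (∀ ρ ≤ r, gaussNorm ρ s < ε) ∧ ∀ ρ ≤ r, ∀ i, gaussNorm ρ (x i) ≤ C := by
  obtain ⟨f, hfI, hf, hgen⟩ := exists_mem_forall_approxDvd (I := N.map p) hI r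
  have hfg : ApproxDvd r f g := by
    intro ε hε
    obtain ⟨y, hy, hgy⟩ := hcl r ε hε
    obtain ⟨q, hq⟩ := hgen y hy ε hε
    exact ⟨q, fun ρ hρ => gaussNorm_sub_lt (hgy ρ hρ) (hq ρ hρ)⟩
  obtain ⟨x, hx, rfl⟩ := hfI
  obtain ⟨m, hm, hmg⟩ := exists_forall_le_gaussNorm hg
  have hbd : ∀ ρ : Set.Ico (α : ℝ) 1, ∃ C : ℝ, 0 < C ∧
      ∀ i, gaussNorm ρ g / gaussNorm ρ (p x) * gaussNorm ρ (x i) ≤ C := by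
    intro ρ
    obtain ⟨C, hC⟩ := (Set.finite_range fun i =>
      gaussNorm ρ g / gaussNorm ρ (p x) * gaussNorm ρ (x i)).bddAbove
    exact ⟨max 1 C, by positivity, fun i => le_max_of_le_right (hC ⟨i, rfl⟩)⟩
  obtain ⟨C₁, hC₁, h1⟩ := hbd (inner α)
  obtain ⟨C₂, hC₂, h2⟩ := hbd r
  refine ⟨max C₁ C₂, by positivity, fun ε hε => ?_⟩
  -- The `1` makes the error less than `|g|_ρ`, which fixes `|w|_ρ`; the `ε` makes `s` small.
  obtain ⟨w, hw⟩ := hfg (min 1 ε * m) (by positivity)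
  have hmem : w • x ∈ N := N.smul_mem w hx
  obtain ⟨v, hv⟩ := hdvd _ ⟨w • x, hmem, rfl⟩
  have hv' : p x * w = g * v := by rw [← hv, map_smul, smul_eq_mul, mul_comm]
  have hs : ∀ ρ ≤ r, gaussNorm ρ (1 - v) < min 1 ε := by
    intro ρ hρ
    have hg0 := gaussNorm_pos hg ρ
    have h3 := hw ρ hρ
    rw [hv', show g - g * v = g * (1 - v) by ring, gaussNorm_mul, mul_comm] at h3
    refine lt_of_mul_lt_mul_right (h3.trans_le ?_) hg0.le
    exact mul_le_mul_of_nonneg_left (hmg ρ) (by positivity)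
  have hwn : ∀ ρ ≤ r, gaussNorm ρ w = gaussNorm ρ g / gaussNorm ρ (p x) := by
    intro ρ hρ
    have hf0 := gaussNorm_pos hf ρ
    rw [eq_div_iff hf0.ne', mul_comm, ← gaussNorm_mul]
    refine gaussNorm_eq_of_sub_lt ?_
    rw [gaussNorm_sub_comm]
    refine (hw ρ hρ).trans_le (le_trans ?_ (hmg ρ))
    exact mul_le_of_le_one_left hm.le (min_le_left _ _)
  refine ⟨w • x, hmem, 1 - v, by rw [sub_sub_cancel, hv], fun ρ hρ =>
    (hs ρ hρ).trans_le (min_le_right _ _), fun ρ hρ i => ?_⟩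
  rw [Pi.smul_apply, smul_eq_mul]
  refine (gaussNorm_le_max hρ _).trans (max_le_max ?_ ?_)
  · rw [gaussNorm_mul, hwn _ (inner_le r)]
    exact h1 i
  · rw [gaussNorm_mul, hwn _ le_rfl]
    exact h2 i

/-- The image of a closed submodule under a coordinate is a principal ideal. -/
theorem IsSeqClosedSubmodule.exists_generator_map (hϖ0 : 0 < ‖ϖ‖) (hϖ1 : ‖ϖ‖ < 1)
    (hϖ : ∀ x : F, x ≠ 0 → ∃ n : ℤ, ‖x‖ = ‖ϖ‖ ^ n) {ι : Type*} [Finite ι]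
    {N : Submodule (AnnulusRing F α) (ι → AnnulusRing F α)} (hN : IsSeqClosedSubmodule N) (i₀ : ι)
    (hI : N.map (LinearMap.proj (φ := fun _ => AnnulusRing F α) i₀) ≠ ⊥) :
    ∃ y ∈ N, y i₀ ≠ 0 ∧ ∀ x ∈ N, y i₀ ∣ x i₀ := by
  set p : (ι → AnnulusRing F α) →ₗ[AnnulusRing F α] AnnulusRing F α :=
    LinearMap.proj (φ := fun _ => AnnulusRing F α) i₀ with hp
  obtain ⟨g, hg, hdvd, hcl⟩ := exists_generator_of_closure hϖ0 hϖ1 hϖ hI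
  obtain ⟨r, hmono, -, hr⟩ := exists_radii α hϖ0 hϖ1
  choose C hC hCx using fun n => exists_bounded_approx hg hdvd hcl hI (r n)
  -- If `x` has coordinate `g (1 - t)` and `y` has `g (1 - s)`, then `x + t • y` has `g (1 - t s)`.
  -- Each `t` is made small against the next bound `C (n + 1)`, so the increments `t • y` tend to
  -- zero.
  obtain ⟨x, hx⟩ := exists_seq_of_forall_exists
    (P := fun n (x : (ι → AnnulusRing F α) × AnnulusRing F α) => x.1 ∈ N ∧
      x.1 i₀ = g * (1 - x.2) ∧ ∀ ρ ≤ r n, gaussNorm ρ x.2 < 1 / ((n : ℝ) + 1) ∧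
        gaussNorm ρ x.2 * C (n + 1) < 1 / ((n : ℝ) + 1))
    (Q := fun n x x' => ∀ ρ ≤ r n, ∀ i, gaussNorm ρ (x'.1 i - x.1 i) ≤ 1 / ((n : ℝ) + 1))
    (by
      have hC' := hC (0 + 1)
      obtain ⟨x, hx, s, h1, h2, -⟩ := hCx 0 (min 1 (1 / C (0 + 1))) (by positivity)
      refine ⟨(x, s), hx, h1, fun ρ hρ => ⟨?_, ?_⟩⟩
      · simpa using (h2 ρ hρ).trans_le (min_le_left _ _)
      · have := (h2 ρ hρ).trans_le (min_le_right _ _)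
        rw [lt_div_iff₀ hC'] at this
        simpa using this)
    (by
      rintro n ⟨x, t⟩ ⟨hxN, hxp, ht⟩
      dsimp only at hxN hxp ht ⊢
      have hC' := hC (n + 1 + 1)
      -- On the larger annulus `t` need not be small; `D` bounds it there so that `s` can
      -- compensate.
      set D : ℝ := max 1 (max (gaussNorm (inner α) t) (gaussNorm (r (n + 1)) t)) with hD
      have hD0 : 0 < D := by positivity
      set E : ℝ := min 1 (1 / C (n + 1 + 1)) * (1 / (((n + 1 : ℕ) : ℝ) + 1)) with hE
      have hE0 : 0 < E := by positivity
      obtain ⟨y, hy, s, h1, h2, h3⟩ := hCx (n + 1) (E / D) (by positivity)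
      have h1' : y i₀ = g * (1 - s) := h1
      have hts : ∀ ρ ≤ r (n + 1), gaussNorm ρ (t * s) < E := by
        intro ρ hρ
        rw [gaussNorm_mul]
        calc gaussNorm ρ t * gaussNorm ρ s ≤ D * gaussNorm ρ s :=
              mul_le_mul_of_nonneg_right ((gaussNorm_le_max hρ t).trans (le_max_right _ _))
                (gaussNorm_nonneg _ _)
          _ < D * (E / D) := mul_lt_mul_of_pos_left (h2 ρ hρ) hD0
          _ = E := mul_div_cancel₀ _ hD0.ne'
      have hpos : (0 : ℝ) < 1 / (((n + 1 : ℕ) : ℝ) + 1) := by positivity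
      refine ⟨(x + t • y, t * s), ⟨N.add_mem hxN (N.smul_mem t hy), ?_, fun ρ hρ => ⟨?_, ?_⟩⟩,
        fun ρ hρ i => ?_⟩
      · simp only [Pi.add_apply, Pi.smul_apply, smul_eq_mul, hxp, h1']
        ring
      · exact (hts ρ hρ).trans_le (mul_le_of_le_one_left hpos.le (min_le_left _ _))
      · rw [← lt_div_iff₀ hC']
        refine (hts ρ hρ).trans_le ?_
        rw [hE]
        exact (mul_le_mul_of_nonneg_right (min_le_right _ _) hpos.le).trans_eq
          (one_div_mul_eq_div _ _)
      · simp only [Pi.add_apply, Pi.smul_apply, smul_eq_mul, add_sub_cancel_left]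
        rw [gaussNorm_mul]
        exact (mul_le_mul_of_nonneg_left (h3 ρ (hρ.trans (hmono n.le_succ)) i)
          (gaussNorm_nonneg _ _)).trans (ht ρ hρ).2.le)
  have hlim := tendsto_one_div_add_atTop_nhds_zero_nat (𝕜 := ℝ)
  have hconv : ∀ i, ∃ y : AnnulusRing F α, ∀ ρ,
      Tendsto (fun n => gaussNorm ρ (y - (x n).1 i)) atTop (𝓝 0) := fun i =>
    exists_tendsto_gaussNorm_sub fun ρ => by
      refine squeeze_zero' (Eventually.of_forall fun n => gaussNorm_nonneg _ _) ?_ hlim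
      filter_upwards [hr ρ] with n hn
      exact (hx n).2 ρ hn i
  choose y hy using hconv
  have hyN : y ∈ N := hN (fun n => (x n).1) y (fun n => (hx n).1.1) fun ρ i => hy i ρ
  have hyg : y i₀ = g := by
    refine eq_of_tendsto_gaussNorm_sub (inner α) (hy i₀ _) ?_
    have h1 := hlim.const_mul (gaussNorm (inner α) g)
    rw [mul_zero] at h1
    refine squeeze_zero (fun n => gaussNorm_nonneg _ _) (fun n => ?_) h1
    rw [(hx n).1.2.1, show g - g * (1 - (x n).2) = g * (x n).2 by ring, gaussNorm_mul]
    exact mul_le_mul_of_nonneg_left ((hx n).1.2.2 _ (inner_le _)).1.le (gaussNorm_nonneg _ _)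
  exact ⟨y, hyN, hyg ▸ hg, fun z hz => hyg ▸ hdvd _ ⟨z, hz, rfl⟩⟩

/-- Closed submodules of a finite power of the ring of analytic functions are free. -/
theorem IsSeqClosedSubmodule.free (hϖ0 : 0 < ‖ϖ‖) (hϖ1 : ‖ϖ‖ < 1)
    (hϖ : ∀ x : F, x ≠ 0 → ∃ n : ℤ, ‖x‖ = ‖ϖ‖ ^ n) {d : ℕ}
    {N : Submodule (AnnulusRing F α) (Fin d → AnnulusRing F α)} (hN : IsSeqClosedSubmodule N) :
    Module.Free (AnnulusRing F α) N ∧ Module.Finite (AnnulusRing F α) N := by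
  induction d with
  | zero =>
    have : Subsingleton N := inferInstance
    exact ⟨Module.Free.of_subsingleton _ _, inferInstance⟩
  | succ d ih =>
    let c : (Fin d → AnnulusRing F α) →ₗ[AnnulusRing F α] (Fin (d + 1) → AnnulusRing F α) :=
      { toFun := fun x => Fin.cons 0 x
        map_add' := fun x y => by
          ext i : 1
          refine Fin.cases ?_ (fun i => ?_) i <;> simp
        map_smul' := fun a x => by
          ext i : 1
          refine Fin.cases ?_ (fun i => ?_) i <;> simp }
    have hc0 : ∀ x, c x 0 = 0 := fun x => rfl
    have hcs : ∀ x i, c x (Fin.succ i) = x i := fun x i => rfl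
    have hctail : ∀ y : Fin (d + 1) → AnnulusRing F α, y 0 = 0 → c (Fin.tail y) = y := by
      intro y hy
      ext i : 1
      refine Fin.cases ?_ (fun i => ?_) i
      · rw [hc0, hy]
      · rw [hcs, Fin.tail]
    have hcinj : Function.Injective c := fun x y h => by
      ext i : 1
      rw [← hcs x, h, hcs]
    -- `N'` is the kernel of the first coordinate on `N`, seen in `R^d`.
    set N' := N.comap c with hN'
    have hcl : IsSeqClosedSubmodule N' := by
      intro x y hx hy
      refine hN (fun n => c (x n)) (c y) hx fun ρ i => ?_
      refine Fin.cases ?_ (fun i => ?_) i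
      · simp [hc0]
      · simpa only [hcs] using hy ρ i
    obtain ⟨hfree, hfin⟩ := ih hcl
    by_cases hI : N.map (LinearMap.proj (φ := fun _ => AnnulusRing F α) (0 : Fin (d + 1))) = ⊥
    · have h0 : ∀ x ∈ N, x 0 = 0 := fun x hx => by
        have : x 0 ∈ N.map (LinearMap.proj (φ := fun _ => AnnulusRing F α) (0 : Fin (d + 1))) :=
          ⟨x, hx, rfl⟩
        rwa [hI, Submodule.mem_bot] at this
      let e : N' ≃ₗ[AnnulusRing F α] N := LinearEquiv.ofBijective
        (c.restrict (p := N') (q := N) fun x hx => hx)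
        ⟨fun x y h => Subtype.ext (hcinj (congrArg Subtype.val h)), fun y =>
          ⟨⟨Fin.tail y.1, by
            change c _ ∈ N
            rw [hctail _ (h0 _ y.2)]
            exact y.2⟩, Subtype.ext (hctail _ (h0 _ y.2))⟩⟩
      exact ⟨Module.Free.of_equiv e, Module.Finite.equiv e⟩
    · obtain ⟨y, hyN, hy0, hy⟩ := hN.exists_generator_map hϖ0 hϖ1 hϖ 0 hI
      let l : N' × AnnulusRing F α →ₗ[AnnulusRing F α] N :=
        (c.restrict (p := N') (q := N) fun x hx => hx).coprod
          (LinearMap.toSpanSingleton (AnnulusRing F α) N ⟨y, hyN⟩)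
      have hl : ∀ x, (l x).1 = c x.1.1 + x.2 • y := fun x => rfl
      let e : (N' × AnnulusRing F α) ≃ₗ[AnnulusRing F α] N := LinearEquiv.ofBijective l
        ⟨by
          rw [injective_iff_map_eq_zero]
          rintro ⟨x, a⟩ h
          have h1 : c x.1 + a • y = 0 := congrArg Subtype.val h
          have h2 := congrFun h1 0
          rw [Pi.add_apply, hc0, zero_add, Pi.smul_apply, smul_eq_mul, Pi.zero_apply] at h2
          obtain rfl : a = 0 := (mul_eq_zero.1 h2).resolve_right hy0
          rw [zero_smul, add_zero] at h1
          have h3 : x.1 = 0 := hcinj (by rw [h1, map_zero])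
          exact Prod.ext (Subtype.ext h3) rfl, by
          rintro ⟨z, hz⟩
          obtain ⟨a, ha⟩ := hy z hz
          have h0 : (z - a • y) 0 = 0 := by
            rw [Pi.sub_apply, Pi.smul_apply, ha, smul_eq_mul, mul_comm, sub_self]
          refine ⟨⟨⟨Fin.tail (z - a • y), ?_⟩, a⟩, Subtype.ext ?_⟩
          · change c _ ∈ N
            rw [hctail _ h0]
            exact N.sub_mem hz (N.smul_mem a hyN)
          · rw [hl]
            change c (Fin.tail (z - a • y)) + a • y = z
            rw [hctail _ h0, sub_add_cancel]⟩
      exact ⟨Module.Free.of_equiv e, Module.Finite.equiv e⟩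

theorem withSeminorms (F : Type*) [NormedField F] (α : Set.Ioo (0 : ℝ) 1) :
    WithSeminorms (gaussSeminorm F α) := ⟨rfl⟩

/-- In the product topology, convergence means convergence of every coordinate in every Gauss norm,
and a closed set contains the limits of its sequences. -/
theorem isSeqClosedSubmodule_map {M : Type*} [AddCommGroup M] [Module (AnnulusRing F α) M]
    {ι : Type*} [Fintype ι] (b : Module.Basis ι (AnnulusRing F α) M)
    {N : Submodule (AnnulusRing F α) M} (hN : IsClosed[basisTopology b] (N : Set M)) :
    IsSeqClosedSubmodule (N.map (b.equivFun : M →ₗ[AnnulusRing F α] ι → AnnulusRing F α)) := by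
  intro x y hx hy
  let _ : TopologicalSpace M := basisTopology b
  refine ⟨b.equivFun.symm y, ?_, b.equivFun.apply_symm_apply y⟩
  refine hN.mem_of_tendsto (f := fun n => b.equivFun.symm (x n)) (b := atTop) ?_
    (Eventually.of_forall fun n => ?_)
  · rw [nhds_induced, tendsto_comap_iff, b.equivFun.apply_symm_apply, tendsto_pi_nhds]
    intro i
    simp only [Function.comp, b.equivFun.apply_symm_apply]
    rw [(withSeminorms F α).tendsto_nhds]
    intro ρ ε hε
    filter_upwards [(hy ρ i).eventually (gt_mem_nhds hε)] with n hn
    rw [gaussNorm_sub_comm] at hn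
    exact hn
  · obtain ⟨z, hz, hzx⟩ := hx n
    rw [← hzx]
    simpa using hz

end AnnulusRing
end

theorem mainTheorem11 {F : Type*} [NormedField F] [CompleteSpace F] [IsUltrametricDist F]
    (hF : ∃ ϖ : F, 0 < ‖ϖ‖ ∧ ‖ϖ‖ < 1 ∧ ∀ x : F, x ≠ 0 → ∃ n : ℤ, ‖x‖ = ‖ϖ‖ ^ n)
    (α : Set.Ioo (0 : ℝ) 1)
    {M : Type*} [AddCommGroup M] [Module (AnnulusRing F α) M]
    (d : ℕ) (b : Module.Basis (Fin d) (AnnulusRing F α) M)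
    (N : Submodule (AnnulusRing F α) M)
    (hN : IsClosed[AnnulusRing.basisTopology b] (N : Set M)) :
    (LinearMap.range (N.subtype.baseChange (FractionRing (AnnulusRing F α))) = ⊤ →
      Nonempty (Module.Basis (Fin d) (AnnulusRing F α) N)) ∧
    (Module.finrank (FractionRing (AnnulusRing F α))
        (FractionRing (AnnulusRing F α) ⊗[AnnulusRing F α] N) ≤ d ∧
      Nonempty (Module.Basis
        (Fin (Module.finrank (FractionRing (AnnulusRing F α))
          (FractionRing (AnnulusRing F α) ⊗[AnnulusRing F α] N)))
        (AnnulusRing F α) N)) := by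
  obtain ⟨ϖ, hϖ0, hϖ1, hϖ⟩ := hF
  obtain ⟨hfree, hfin⟩ := (AnnulusRing.isSeqClosedSubmodule_map b hN).free hϖ0 hϖ1 hϖ
  let e := b.equivFun.submoduleMap N
  have : Module.Free (AnnulusRing F α) N := Module.Free.of_equiv e.symm
  have : Module.Finite (AnnulusRing F α) N := Module.Finite.equiv e.symm
  have : Module.Free (AnnulusRing F α) M := Module.Free.of_basis b
  have : Module.Finite (AnnulusRing F α) M := Module.Finite.of_basis b
  have hM : Module.finrank (AnnulusRing F α) M = d := by
    rw [Module.finrank_eq_card_basis b, Fintype.card_fin]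
  have hle : Module.finrank (AnnulusRing F α) N ≤ d :=
    hM ▸ LinearMap.finrank_le_finrank_of_injective N.injective_subtype
  rw [Module.finrank_baseChange]
  refine ⟨fun h => ?_, hle, ⟨Module.finBasis _ _⟩⟩
  -- Surjectivity over the fraction field gives `d ≤ rank N`, the inequality opposite to `hle`.
  have h1 := LinearMap.finrank_le_finrank_of_surjective (LinearMap.range_eq_top.1 h)
  rw [Module.finrank_baseChange, Module.finrank_baseChange, hM] at h1
  exact ⟨Module.finBasisOfFinrankEq _ _ (le_antisymm hle h1)⟩
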